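/- Let $n\ge 1$ and let $S_n$ be the symmetric group on $\{1,\dots,n\}$, with simple transpositions $s_i=(i,i+1)$ and with $\ell(w)$ the number of inversions of $w$; products of permutations are compositions of maps, $(vw)(k)=v(w(k))$. Let $X=(x_1,x_2,\dots)$ and $Y=(y_1,y_2,\dots)$ be commuting independent variables. The double Grothendieck polynomials $\mathfrak G_w(X;Y)$, $w\in S_n$, are defined recursively by $$\mathfrak G_{w_0}(X;Y)=\prod_{i+j\le n}(x_i+y_j-x_iy_j)$$ for the longest permutation $w_0\in S_n$, and $\mathfrak G_w=\pi_i(\mathfrak G_{ws_i})$ for any $i$ with $\ell(ws_i)=\ell(w)+1$ if $w\neq w_0$, where $$\pi_i(f)=\frac{(1-x_{i+1})f(\dots,x_i,x_{i+1},\dots)-(1-x_i)f(\dots,x_{i+1},x_i,\dots)}{x_i-x_{i+1}}.$$ The degenerate Hecke algebra is the associative $\mathbb Z$-algebra with generators $s_1,s_2,\dots$ and relations $s_i^2=s_i$, $s_is_j=s_js_i$ for $|i-j|>1$, and $s_is_{i+1}s_i=s_{i+1}s_is_{i+1}$; a permutation $w$ is regarded as the element of it given by any reduced word of $w$. **Theorem.**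 Let $w\in S_n$, let $x^uy^v=x_1^{u_1}\cdots x_{n-1}^{u_{n-1}}y_1^{v_1}\cdots y_{n-1}^{v_{n-1}}$ be a monomial, and set $g_i=\sum_{k=n-i}^{n-1}v_k$ and $f_i=g_{n-1}+\sum_{k=1}^{i}u_k$ for $0\le i\le n-1$, and $r=f_{n-1}=|u|+|v|$. Then the number of factorizations $w=s_{e_1}\cdots s_{e_r}$ in the degenerate Hecke algebra such that $$n-i\le e_{g_{i-1}+1}<\dots<e_{g_i}\qquad\text{and}\qquad e_{f_{i-1}+1}>\dots>e_{f_i}\ge i\qquad\text{for all }1\le i\le n-1$$ is finite, and the coefficient of $x^uy^v$ in $\mathfrak G_w(X;Y)$ is equal to $(-1)^{r-\ell(w)}$ times this number. (A chain of inequalities without terms, i.e. with $g_{i-1}=g_i$ or $f_{i-1}=f_i$, imposes no condition.) -/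

import Mathlib

/-! Double Grothendieck polynomials and the degenerate Hecke algebra.

A permutation `w ∈ S_n` is an element of `Equiv.Perm (Fin n)`, the element `k : Fin n` standing for
the number `k + 1 ∈ {1, …, n}`; products are compositions of maps, `(v * w) k = v (w k)`. -/

/-- The simple transposition `s_{k+1} = (k+1, k+2)` of `S_n`, for `k = 0, …, n - 2`. -/
def simpleTransposition {n : ℕ} (k : Fin (n - 1)) : Equiv.Perm (Fin n) :=
  Equiv.swap ⟨k.val, by omega⟩ ⟨k.val + 1, by omega⟩

/-- The inversions of `w`. -/
def permInversions {n : ℕ} (w : Equiv.Perm (Fin n)) : Finset (Fin n × Fin n) :=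
  Finset.univ.filter fun p => p.1 < p.2 ∧ w p.2 < w p.1

theorem mem_permInversions {n : ℕ} (w : Equiv.Perm (Fin n)) (a b : Fin n) :
    (a, b) ∈ permInversions w ↔ a < b ∧ w b < w a := by
  unfold permInversions
  exact Finset.mem_filter_univ (a, b)

/-- The length `ℓ(w)`, the number of inversions of `w`. -/
def permLength {n : ℕ} (w : Equiv.Perm (Fin n)) : ℕ := (permInversions w).card

/-- `[k_1, …, k_m]` is a reduced word of `w`: the corresponding simple transpositions have
product `w` in the symmetric group, and `m = ℓ(w)`. -/
def IsReducedWord {n : ℕ} (w : Equiv.Perm (Fin n)) (l : List (Fin (n - 1))) : Prop :=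
  (l.map simpleTransposition).prod = w ∧ l.length = permLength w

theorem permLength_mul_simple {n : ℕ} (w : Equiv.Perm (Fin n)) (k : Fin (n - 1))
    (h : w ⟨k.val, by omega⟩ < w ⟨k.val + 1, by omega⟩) :
    permLength (w * simpleTransposition k) = permLength w + 1 := by
  obtain ⟨k, hk⟩ := k
  set i : Fin n := ⟨k, by omega⟩ with hi
  set j : Fin n := ⟨k + 1, by omega⟩ with hj
  have hs : simpleTransposition (n := n) ⟨k, hk⟩ = Equiv.swap i j := rfl
  have hij : i ≠ j := by simp [hi, hj]
  have key : ∀ a b : Fin n, a < b → ¬ (a = i ∧ b = j) → Equiv.swap i j a < Equiv.swap i j b := by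
    intro a b hab hne
    rw [Equiv.swap_apply_def, Equiv.swap_apply_def]
    rw [Fin.lt_def] at hab ⊢
    simp only [Fin.ext_iff, hi, hj] at hne ⊢
    split_ifs <;> try dsimp only
    all_goals omega
  have hset : permInversions (w * Equiv.swap i j) =
      insert (i, j) ((permInversions w).image fun p => (Equiv.swap i j p.1, Equiv.swap i j p.2)) := by
    ext ⟨a, b⟩
    simp only [mem_permInversions, Equiv.Perm.mul_apply,
      Finset.mem_insert, Finset.mem_image, Prod.mk.injEq, Prod.exists]
    constructor
    · rintro ⟨hab, hw⟩
      by_cases hne : a = i ∧ b = j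
      · exact Or.inl hne
      · exact Or.inr ⟨_, _, ⟨key a b hab hne, hw⟩, by simp, by simp⟩
    · rintro (⟨rfl, rfl⟩ | ⟨c, d, ⟨hcd, hw⟩, rfl, rfl⟩)
      · refine ⟨by simp [hi, hj], by simpa using h⟩
      · refine ⟨key c d hcd ?_, by simpa using hw⟩
        rintro ⟨rfl, rfl⟩
        exact absurd h (not_lt.mpr hw.le)
  have hnot : (i, j) ∉ (permInversions w).image
      fun p => (Equiv.swap i j p.1, Equiv.swap i j p.2) := by
    simp only [mem_permInversions,
      Finset.mem_image, Prod.mk.injEq, Prod.exists, not_exists, not_and]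
    rintro c d ⟨hcd, -⟩ hc hd
    have hc' : c = j := by
      have := congrArg (Equiv.swap i j) hc
      simpa using this
    have hd' : d = i := by
      have := congrArg (Equiv.swap i j) hd
      simpa using this
    subst hc' hd'
    simp [hi, hj] at hcd
  rw [permLength, permLength, hs, hset, Finset.card_insert_of_notMem hnot,
    Finset.card_image_of_injective]
  rintro ⟨a, b⟩ ⟨c, d⟩ hp
  simpa using hp

theorem perm_eq_one_of_no_descent {n : ℕ} (w : Equiv.Perm (Fin n))
    (h : ∀ k : Fin (n - 1), w ⟨k.val, by omega⟩ < w ⟨k.val + 1, by omega⟩) : w = 1 := by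
  cases n with
  | zero => exact Subsingleton.elim _ _
  | succ n =>
    have hm : StrictMono w := Fin.strictMono_iff_lt_succ.2 fun i => h i
    have := hm.range_inj (g := id) strictMono_id |>.1 (by simp [w.surjective.range_eq])
    exact Equiv.ext fun x => congrFun this x

theorem exists_isReducedWord {n : ℕ} (w : Equiv.Perm (Fin n)) : ∃ l, IsReducedWord w l := by
  induction hN : permLength w using Nat.strong_induction_on generalizing w with
  | _ N ih =>
    by_cases h : ∀ k : Fin (n - 1), w ⟨k.val, by omega⟩ < w ⟨k.val + 1, by omega⟩
    · refine ⟨[], ?_, ?_⟩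
      · simp [perm_eq_one_of_no_descent w h]
      · rw [perm_eq_one_of_no_descent w h]
        symm
        simp only [permLength, List.length_nil, Finset.card_eq_zero]
        ext ⟨a, b⟩
        simp only [mem_permInversions, Equiv.Perm.one_apply,
          Finset.notMem_empty, iff_false, not_and, not_lt]
        exact fun hab => hab.le
    · push Not at h
      obtain ⟨k, hk⟩ := h
      have hss : w * simpleTransposition k * simpleTransposition k = w := by
        simp [simpleTransposition, mul_assoc]
      have hlt : w ⟨k.val + 1, by omega⟩ < w ⟨k.val, by omega⟩ :=
        lt_of_le_of_ne hk (by simp)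
      have hl := permLength_mul_simple (w * simpleTransposition k) k
        (by simpa [simpleTransposition] using hlt)
      rw [hss] at hl
      obtain ⟨l, hl1, hl2⟩ := ih _ (by omega) (w * simpleTransposition k) rfl
      exact ⟨l ++ [k], by simp [hl1, hss], by simp [hl2, hl]⟩

/-! ### The degenerate Hecke algebra -/

/-- The defining relations of the degenerate Hecke algebra, between words in the
generators `s_1, s_2, …` of a free associative `ℤ`-algebra. -/
inductive DegenerateHeckeRel : FreeAlgebra ℤ ℕ+ → FreeAlgebra ℤ ℕ+ → Prop
  | idem (i : ℕ+) :
      DegenerateHeckeRel (FreeAlgebra.ι ℤ i * FreeAlgebra.ι ℤ i) (FreeAlgebra.ι ℤ i)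
  | comm (i j : ℕ+) (h : 1 < |(i : ℤ) - (j : ℤ)|) :
      DegenerateHeckeRel (FreeAlgebra.ι ℤ i * FreeAlgebra.ι ℤ j)
        (FreeAlgebra.ι ℤ j * FreeAlgebra.ι ℤ i)
  | braid (i : ℕ+) :
      DegenerateHeckeRel
        (FreeAlgebra.ι ℤ i * FreeAlgebra.ι ℤ (i + 1) * FreeAlgebra.ι ℤ i)
        (FreeAlgebra.ι ℤ (i + 1) * FreeAlgebra.ι ℤ i * FreeAlgebra.ι ℤ (i + 1))

/-- The degenerate Hecke algebra over `ℤ`. -/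
abbrev DegenerateHecke : Type := RingQuot DegenerateHeckeRel

/-- The generator `s_i` of the degenerate Hecke algebra, `i = 1, 2, …`. -/
noncomputable def heckeGen (i : ℕ+) : DegenerateHecke :=
  RingQuot.mkAlgHom ℤ DegenerateHeckeRel (FreeAlgebra.ι ℤ i)

/-- The permutation `w`, seen as an element of the degenerate Hecke algebra: the product of the
generators along a reduced word of `w` (by the braid relations, whichever is taken). -/
noncomputable def heckeOfPerm {n : ℕ} (w : Equiv.Perm (Fin n)) : DegenerateHecke :=
  ((exists_isReducedWord w).choose.map fun k => heckeGen k.val.succPNat).prod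

/-! ### Double Grothendieck polynomials -/

/-- The ring `ℤ[X; Y]`; the variables `x_1, x_2, …` and `y_1, y_2, …` are those with positive index
(variables of index `0` are not used). -/
abbrev DoublePoly : Type := MvPolynomial (ℕ ⊕ ℕ) ℤ

/-- The variable `x_i`. -/
noncomputable def xVar (i : ℕ) : DoublePoly := MvPolynomial.X (Sum.inl i)

/-- The variable `y_i`. -/
noncomputable def yVar (i : ℕ) : DoublePoly := MvPolynomial.X (Sum.inr i)

/-- The polynomial obtained from `f` by exchanging `x_i` and `x_{i+1}`. -/
noncomputable def swapX (i : ℕ) (f : DoublePoly) : DoublePoly :=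
  MvPolynomial.rename (Equiv.swap (Sum.inl i) (Sum.inl (i + 1)) : Equiv.Perm (ℕ ⊕ ℕ)) f

theorem isobaric_dvd (i : ℕ) (f : DoublePoly) :
    xVar i - xVar (i + 1) ∣ (1 - xVar (i + 1)) * f - (1 - xVar i) * swapX i f := by
  have h : ∀ g : DoublePoly, xVar i - xVar (i + 1) ∣ g - swapX i g := by
    intro g
    induction g using MvPolynomial.induction_on with
    | C a => simp [swapX]
    | add p q hp hq =>
      have : p + q - swapX i (p + q) = (p - swapX i p) + (q - swapX i q) := by
        simp only [swapX, map_add]; ring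
      rw [this]
      exact dvd_add hp hq
    | mul_X p v hp =>
      have : p * MvPolynomial.X v - swapX i (p * MvPolynomial.X v) =
          (p - swapX i p) * MvPolynomial.X v +
            swapX i p * (MvPolynomial.X v - swapX i (MvPolynomial.X v)) := by
        simp only [swapX, map_mul]; ring
      rw [this]
      refine dvd_add (Dvd.dvd.mul_right hp _) (Dvd.dvd.mul_left ?_ _)
      simp only [swapX, MvPolynomial.rename_X, xVar, Equiv.swap_apply_def]
      split_ifs with h1 h2
      · rw [h1]
      · rw [h2, ← dvd_neg, neg_sub]
      · simp
  have := h ((1 - xVar (i + 1)) * f)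
  have e : swapX i ((1 - xVar (i + 1)) * f) = (1 - xVar i) * swapX i f := by
    simp [swapX, xVar]
  rwa [e] at this

/-- The isobaric divided difference operator `π_i`: the exact quotient of
`(1 - x_{i+1}) f(…, x_i, x_{i+1}, …) - (1 - x_i) f(…, x_{i+1}, x_i, …)` by `x_i - x_{i+1}`. -/
noncomputable def isobaricDD (i : ℕ) (f : DoublePoly) : DoublePoly := (isobaric_dvd i f).choose

theorem isobaricDD_spec (i : ℕ) (f : DoublePoly) :
    (xVar i - xVar (i + 1)) * isobaricDD i f =
      (1 - xVar (i + 1)) * f - (1 - xVar i) * swapX i f :=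
  (isobaric_dvd i f).choose_spec.symm

/-- `IsDoubleGrothendieck w P`: the polynomial `P` arises as the double Grothendieck polynomial
`𝔊_w(X; Y)` of `w ∈ S_n` by the recursive definition. It is
`∏_{i+j ≤ n} (x_i + y_j - x_i y_j)` for the longest permutation `m ↦ n + 1 - m`, and
`𝔊_w = π_i 𝔊_{w s_i}` for any `i` with `ℓ(w s_i) = ℓ(w) + 1` (in `step`, `i = k + 1`). -/
inductive IsDoubleGrothendieck {n : ℕ} : Equiv.Perm (Fin n) → DoublePoly → Prop
  | longest :
      IsDoubleGrothendieck Fin.revPerm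
        (∏ p ∈ (Finset.Icc 1 n ×ˢ Finset.Icc 1 n).filter (fun p => p.1 + p.2 ≤ n),
          (xVar p.1 + yVar p.2 - xVar p.1 * yVar p.2))
  | step (w : Equiv.Perm (Fin n)) (k : Fin (n - 1)) (P : DoublePoly)
      (hlen : permLength (w * simpleTransposition k) = permLength w + 1)
      (hP : IsDoubleGrothendieck (w * simpleTransposition k) P) :
      IsDoubleGrothendieck w (isobaricDD (k.val + 1) P)

/-- Every permutation has a double Grothendieck polynomial. -/
theorem exists_isDoubleGrothendieck {n : ℕ} (w : Equiv.Perm (Fin n)) :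
    ∃ P, IsDoubleGrothendieck w P := by
  have hb : ∀ v : Equiv.Perm (Fin n), permLength v ≤ Fintype.card (Fin n × Fin n) :=
    fun v => Finset.card_le_univ _
  induction hN : Fintype.card (Fin n × Fin n) - permLength w using Nat.strong_induction_on
    generalizing w with
  | _ N ih =>
    by_cases h : ∃ k : Fin (n - 1), w ⟨k.val, by omega⟩ < w ⟨k.val + 1, by omega⟩
    · obtain ⟨k, hk⟩ := h
      have hl := permLength_mul_simple w k hk
      have := hb (w * simpleTransposition k)
      obtain ⟨P, hP⟩ := ih _ (by omega) (w * simpleTransposition k) rfl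
      exact ⟨_, .step w k P hl hP⟩
    · push Not at h
      have h1 : Fin.revPerm * w = 1 := by
        apply perm_eq_one_of_no_descent
        intro k
        simp only [Equiv.Perm.mul_apply, Fin.revPerm_apply, Fin.rev_lt_rev]
        exact lt_of_le_of_ne (h k) (by simp)
      have h2 : w = Fin.revPerm := by
        ext x
        have := congrArg Fin.rev (Equiv.congr_fun h1 x)
        simp only [Equiv.Perm.mul_apply, Fin.revPerm_apply, Fin.rev_rev,
          Equiv.Perm.one_apply] at this
        simp [this]
      subst h2
      exact ⟨_, IsDoubleGrothendieck.longest⟩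

/-- The exponent vector of `x_1^{u_1} ⋯ x_{n-1}^{u_{n-1}} y_1^{v_1} ⋯ y_{n-1}^{v_{n-1}}`; only the
values of `u` and `v` on `{1, …, n - 1}` matter. -/
noncomputable def doubleMonomial (n : ℕ) (u v : ℕ → ℕ) : (ℕ ⊕ ℕ) →₀ ℕ :=
  ∑ k ∈ Finset.Icc 1 (n - 1), Finsupp.single (Sum.inl k) (u k) +
    ∑ k ∈ Finset.Icc 1 (n - 1), Finsupp.single (Sum.inr k) (v k)

/-- `g_i = v_{n-i} + ⋯ + v_{n-1}`. -/
def gIndex (n : ℕ) (v : ℕ → ℕ) (i : ℕ) : ℕ := ∑ k ∈ Finset.Icc (n - i) (n - 1), v k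

/-- `f_i = g_{n-1} + u_1 + ⋯ + u_i`. -/
def fIndex (n : ℕ) (u v : ℕ → ℕ) (i : ℕ) : ℕ := gIndex n v (n - 1) + ∑ k ∈ Finset.Icc 1 i, u k

/-- The conditions on the sequence `e_1, …, e_r` (`e_j` is `e ⟨j - 1, _⟩`): for `1 ≤ i ≤ n - 1`,
`n - i ≤ e_{g_{i-1}+1} < ⋯ < e_{g_i}` and `e_{f_{i-1}+1} > ⋯ > e_{f_i} ≥ i`. Each chain says that
its terms satisfy the bound and are strictly monotone, and nothing if it has no terms. -/
def IsCompatibleSeq (n : ℕ) (u v : ℕ → ℕ) {r : ℕ} (e : Fin r → ℕ+) : Prop :=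
  ∀ i ∈ Finset.Icc 1 (n - 1),
    (∀ j : Fin r, gIndex n v (i - 1) < j.val + 1 → j.val + 1 ≤ gIndex n v i →
      n - i ≤ (e j : ℕ)) ∧
    (∀ j k : Fin r, gIndex n v (i - 1) < j.val + 1 → j < k → k.val + 1 ≤ gIndex n v i →
      e j < e k) ∧
    (∀ j k : Fin r, fIndex n u v (i - 1) < j.val + 1 → j < k → k.val + 1 ≤ fIndex n u v i →
      e k < e j) ∧
    (∀ j : Fin r, fIndex n u v (i - 1) < j.val + 1 → j.val + 1 ≤ fIndex n u v i →
      i ≤ (e j : ℕ))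

/-- The factorizations `w = s_{e_1} ⋯ s_{e_r}` in the degenerate Hecke algebra, `r = f_{n-1}`,
whose index sequence satisfies the conditions above. -/
def bjsFactorizations {n : ℕ} (w : Equiv.Perm (Fin n)) (u v : ℕ → ℕ) :
    Set (Fin (fIndex n u v (n - 1)) → ℕ+) :=
  {e | (List.ofFn fun j => heckeGen (e j)).prod = heckeOfPerm w ∧ IsCompatibleSeq n u v e}

/-!
Put `N = n - 1`, and index generators from zero, so that `t_k` stands for `s_{k+1}`. The theorem
follows from the generating function of Fomin and Kirillov,
`Φ = B_{N-1}(y_N) ⋯ B_0(y_1) A_0(x_1) ⋯ A_{N-1}(x_N)` with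
`A_i(x) = (1 - x t_{N-1}) ⋯ (1 - x t_i)` and `B_i(y) = (1 - y t_i) ⋯ (1 - y t_{N-1})`. On the one
hand, multiplying out `Φ` and collecting the coefficient of a monomial gives a sum over compatible
words, with a sign for each letter. On the other hand, `Φ = ∑_w (-1)^ℓ(w) 𝔊_w w`. For the second
statement two properties of `Φ` are needed, both consequences of the Yang–Baxter equation
`IsDegenerateHecke.yangBaxter`.

* `IsDegenerateHecke.fominKirillov_symm`: `Φ (1 - x_{i+1} s_i)` is symmetric in `x_i` and `x_{i+1}`,
  because `A_i(x)` and `A_i(y)` commute (`IsDegenerateHecke.descProd_comm`). Comparing coefficients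
  at `w` and at `w s_i > w` gives `𝔊_w = π_i 𝔊_{w s_i}` (`isobaricDD_fominKirillovXY`).
* `IsDegenerateHecke.fominKirillov_eq`: the relation
  `B_i(y) A_i(x) = A_{i+1}(x) (1 - (x + y - x y) t_i) B_{i+1}(y)` rearranges `Φ` into a product of
  `ℓ(w_0)` factors whose parameters are the `x_i + y_j - x_i y_j`, `i + j ≤ n`. Every one of them
  has to contribute to the coefficient of `w_0`, which is therefore the product that defines
  `𝔊_{w_0}` (`isTopEntry_fominKirillov`).

Coefficients "at `w`" make sense in a representation: the degenerate Hecke algebra acts on the free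
module on `S_n` by Demazure's operation, and the coefficient at `w` is the entry at `(1, w)` of a
matrix. The generators `s_n, s_{n+1}, …` act by zero, which shows that they do not occur in a
factorization of `w ∈ S_n`. That the matrix entry detects equality in the abstract algebra
(`prod_heckeMatrix_apply`) uses Matsumoto's theorem (`IsReducedWord.heckeWord_eq`).
-/

/-! ### Reduced words and the Demazure action -/

theorem simpleTransposition_mul_self {n : ℕ} (k : Fin (n - 1)) :
    simpleTransposition k * simpleTransposition k = 1 := by
  simp [simpleTransposition]

theorem mul_simple_mul_simple {n : ℕ} (w : Equiv.Perm (Fin n)) (k : Fin (n - 1)) :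
    w * simpleTransposition k * simpleTransposition k = w := by
  rw [mul_assoc, simpleTransposition_mul_self, mul_one]

theorem mul_simple_apply_left {n : ℕ} (w : Equiv.Perm (Fin n)) (k : Fin (n - 1)) :
    (w * simpleTransposition k) ⟨k.val, by omega⟩ = w ⟨k.val + 1, by omega⟩ := by
  simp [simpleTransposition]

theorem mul_simple_apply_right {n : ℕ} (w : Equiv.Perm (Fin n)) (k : Fin (n - 1)) :
    (w * simpleTransposition k) ⟨k.val + 1, by omega⟩ = w ⟨k.val, by omega⟩ := by
  simp [simpleTransposition]

theorem mul_simple_apply_of_ne {n : ℕ} (w : Equiv.Perm (Fin n)) (k : Fin (n - 1)) (p : Fin n)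
    (h1 : p.val ≠ k.val) (h2 : p.val ≠ k.val + 1) : (w * simpleTransposition k) p = w p := by
  rw [Equiv.Perm.mul_apply, simpleTransposition, Equiv.swap_apply_of_ne_of_ne]
  · simpa [Fin.ext_iff] using h1
  · simpa [Fin.ext_iff] using h2

theorem perm_val_ne {n : ℕ} (w : Equiv.Perm (Fin n)) {a b : Fin n} (h : a.val ≠ b.val) :
    w a ≠ w b := fun e => h (congrArg Fin.val (w.injective e))

theorem permLength_of_descent {n : ℕ} (w : Equiv.Perm (Fin n)) (k : Fin (n - 1))
    (h : w ⟨k.val + 1, by omega⟩ < w ⟨k.val, by omega⟩) :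
    permLength w = permLength (w * simpleTransposition k) + 1 := by
  have := permLength_mul_simple (w * simpleTransposition k) k
    (by rw [mul_simple_apply_left, mul_simple_apply_right]; exact h)
  rwa [mul_simple_mul_simple] at this

theorem lt_or_gt_simple {n : ℕ} (w : Equiv.Perm (Fin n)) (k : Fin (n - 1)) :
    w ⟨k.val, by omega⟩ < w ⟨k.val + 1, by omega⟩ ∨
      w ⟨k.val + 1, by omega⟩ < w ⟨k.val, by omega⟩ :=
  lt_or_gt_of_ne (perm_val_ne w (by simp))

theorem ascent_of_permLength {n : ℕ} (w : Equiv.Perm (Fin n)) (k : Fin (n - 1))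
    (h : permLength (w * simpleTransposition k) = permLength w + 1) :
    w ⟨k.val, by omega⟩ < w ⟨k.val + 1, by omega⟩ := by
  rcases lt_or_gt_simple w k with h1 | h1
  · exact h1
  · have := permLength_of_descent w k h1
    omega

theorem permLength_mul_simple_le {n : ℕ} (w : Equiv.Perm (Fin n)) (k : Fin (n - 1)) :
    permLength (w * simpleTransposition k) ≤ permLength w + 1 := by
  rcases lt_or_gt_simple w k with h | h
  · exact (permLength_mul_simple w k h).le
  · have := permLength_of_descent w k h
    omega

@[simp] theorem permLength_one {n : ℕ} : permLength (1 : Equiv.Perm (Fin n)) = 0 := by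
  rw [permLength, Finset.card_eq_zero, Finset.eq_empty_iff_forall_notMem]
  rintro ⟨a, b⟩ h
  rw [mem_permInversions] at h
  exact absurd h.1 (not_lt.2 h.2.le)

theorem permLength_prod_le {n : ℕ} (l : List (Fin (n - 1))) :
    permLength (l.map simpleTransposition).prod ≤ l.length := by
  induction l using List.reverseRecOn with
  | nil => simp
  | append_singleton l k ih =>
    have := permLength_mul_simple_le (l.map simpleTransposition).prod k
    simp only [List.map_append, List.map_cons, List.map_nil, List.prod_append, List.prod_singleton,
      List.length_append, List.length_singleton]
    omega

theorem IsReducedWord.snoc {n : ℕ} {w : Equiv.Perm (Fin n)} {l : List (Fin (n - 1))}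
    {k : Fin (n - 1)} (h : IsReducedWord (w * simpleTransposition k) l)
    (hk : w ⟨k.val + 1, by omega⟩ < w ⟨k.val, by omega⟩) : IsReducedWord w (l ++ [k]) := by
  refine ⟨?_, ?_⟩
  · simp [h.1, mul_simple_mul_simple]
  · rw [permLength_of_descent w k hk, List.length_append, h.2, List.length_singleton]

/-- A prefix of a reduced word is reduced, since a word of length `m` cannot represent a
permutation of length more than `m`. -/
theorem IsReducedWord.of_snoc {n : ℕ} {w : Equiv.Perm (Fin n)} {l : List (Fin (n - 1))}
    {k : Fin (n - 1)} (h : IsReducedWord w (l ++ [k])) :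
    IsReducedWord (w * simpleTransposition k) l ∧
      w ⟨k.val + 1, by omega⟩ < w ⟨k.val, by omega⟩ := by
  obtain ⟨h1, h2⟩ := h
  have e : (l.map simpleTransposition).prod = w * simpleTransposition k := by
    rw [← h1]
    simp [mul_assoc, simpleTransposition_mul_self]
  have hle := permLength_prod_le l
  rw [e] at hle
  rw [List.length_append, List.length_singleton] at h2
  rcases lt_or_gt_simple w k with h | h
  · have := permLength_mul_simple w k h
    omega
  · have := permLength_of_descent w k h
    exact ⟨⟨e, by omega⟩, h⟩

theorem isReducedWord_nil_iff {n : ℕ} {w : Equiv.Perm (Fin n)} : IsReducedWord w [] ↔ w = 1 := by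
  constructor
  · rintro ⟨h, -⟩
    simpa using h.symm
  · rintro rfl
    exact ⟨by simp, by simp⟩

theorem simpleTransposition_comm {n : ℕ} {i j : Fin (n - 1)} (h : i.val + 1 < j.val) :
    simpleTransposition i * simpleTransposition j =
      simpleTransposition j * simpleTransposition (n := n) i := by
  unfold simpleTransposition
  apply Equiv.Perm.Disjoint.commute
  intro p
  by_cases hp : p.val = i.val ∨ p.val = i.val + 1
  · right
    apply Equiv.swap_apply_of_ne_of_ne <;> (rw [Ne, Fin.ext_iff]; dsimp only; omega)
  · left
    apply Equiv.swap_apply_of_ne_of_ne <;> (rw [Ne, Fin.ext_iff]; dsimp only; omega)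

theorem simpleTransposition_braid {n : ℕ} {i j : Fin (n - 1)} (h : i.val + 1 = j.val) :
    simpleTransposition i * simpleTransposition j * simpleTransposition i =
      simpleTransposition j * simpleTransposition i * simpleTransposition (n := n) j := by
  obtain ⟨i, hi⟩ := i
  obtain ⟨j, hj⟩ := j
  dsimp only at h
  subst h
  have key : ∀ a b c : Fin n, a ≠ b → a ≠ c → b ≠ c →
      Equiv.swap a b * Equiv.swap b c * Equiv.swap a b =
        Equiv.swap b c * Equiv.swap a b * Equiv.swap b c := by
    intro a b c hab hac hbc
    rw [Equiv.swap_mul_swap_mul_swap hab hac, Equiv.swap_comm a b, Equiv.swap_comm b c,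
      Equiv.swap_mul_swap_mul_swap hbc.symm hac.symm, Equiv.swap_comm]
  exact key _ _ _ (by simp) (by simp; omega) (by simp)

/-- The generator of the degenerate Hecke algebra with zero-based index `k`, i.e. `s_{k+1}`. -/
noncomputable def heckeSucc (k : ℕ) : DegenerateHecke := heckeGen k.succPNat

theorem heckeSucc_idem (k : ℕ) : heckeSucc k * heckeSucc k = heckeSucc k := by
  have := RingQuot.mkAlgHom_rel ℤ (DegenerateHeckeRel.idem k.succPNat)
  simp only [map_mul] at this
  exact this

theorem heckeSucc_comm {i j : ℕ} (h : i + 1 < j) :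
    heckeSucc i * heckeSucc j = heckeSucc j * heckeSucc i := by
  have := RingQuot.mkAlgHom_rel ℤ (DegenerateHeckeRel.comm i.succPNat j.succPNat (by
    simp only [Nat.succPNat_coe, lt_abs]; right; push_cast; omega))
  simp only [map_mul] at this
  exact this

theorem heckeSucc_braid (i : ℕ) : heckeSucc i * heckeSucc (i + 1) * heckeSucc i =
    heckeSucc (i + 1) * heckeSucc i * heckeSucc (i + 1) := by
  have := RingQuot.mkAlgHom_rel ℤ (DegenerateHeckeRel.braid i.succPNat)
  simp only [map_mul] at this
  exact this

/-- The product of the generators of the degenerate Hecke algebra along a word. -/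
noncomputable def heckeWord {n : ℕ} (l : List (Fin (n - 1))) : DegenerateHecke :=
  (l.map fun k => heckeSucc k.val).prod

theorem heckeWord_snoc {n : ℕ} (l : List (Fin (n - 1))) (k : Fin (n - 1)) :
    heckeWord (l ++ [k]) = heckeWord l * heckeSucc k := by
  simp [heckeWord]

/-- Matsumoto's theorem for the symmetric group: the product of the generators of the degenerate
Hecke algebra along a reduced word depends only on the permutation. If the two words end in
different letters `i` and `j`, then `w` has descents at both, and one passes from one word to the
other through reduced words of `w` that end in the two sides of the braid relation of `i` and `j`. -/
theorem IsReducedWord.heckeWord_eq {n : ℕ} {w : Equiv.Perm (Fin n)} {l l' : List (Fin (n - 1))}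
    (hl : IsReducedWord w l) (hl' : IsReducedWord w l') : heckeWord l = heckeWord l' := by
  induction hN : permLength w using Nat.strong_induction_on generalizing w l l' with
  | _ N ih =>
    rcases List.eq_nil_or_concat' l with rfl | ⟨a, i, rfl⟩
    · rw [List.eq_nil_of_length_eq_zero (hl'.2.trans hl.2.symm)]
    rcases List.eq_nil_or_concat' l' with rfl | ⟨b, j, rfl⟩
    · have := hl.2.trans hl'.2.symm
      simp at this
    obtain ⟨ha, hi⟩ := hl.of_snoc
    obtain ⟨hb, hj⟩ := hl'.of_snoc
    have hLi := permLength_of_descent w i hi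
    have hLj := permLength_of_descent w j hj
    rw [heckeWord_snoc, heckeWord_snoc]
    -- The case of distinct last letters is symmetric in the two words.
    have main : ∀ (i j : Fin (n - 1)) (a b : List (Fin (n - 1))), i.val < j.val →
        IsReducedWord (w * simpleTransposition i) a → IsReducedWord (w * simpleTransposition j) b →
        w ⟨i.val + 1, by omega⟩ < w ⟨i.val, by omega⟩ →
        w ⟨j.val + 1, by omega⟩ < w ⟨j.val, by omega⟩ →
        heckeWord a * heckeSucc i = heckeWord b * heckeSucc j := by
      intro i j a b hij ha hb hi hj
      have hLi := permLength_of_descent w i hi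
      have hLj := permLength_of_descent w j hj
      rcases Nat.lt_or_ge (i.val + 1) j.val with h | h
      · obtain ⟨c, hc⟩ :=
          exists_isReducedWord (w * simpleTransposition i * simpleTransposition j)
        have hc' : IsReducedWord (w * simpleTransposition j * simpleTransposition i) c := by
          rwa [mul_assoc, ← simpleTransposition_comm h, ← mul_assoc]
        have e1 := ih _ (by omega) ha (hc.snoc (by
          rwa [mul_simple_apply_of_ne _ _ _ (by dsimp only; omega) (by dsimp only; omega),
            mul_simple_apply_of_ne _ _ _ (by dsimp only; omega) (by dsimp only; omega)])) rfl
        have e2 := ih _ (by omega) hb (hc'.snoc (by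
          rwa [mul_simple_apply_of_ne _ _ _ (by dsimp only; omega) (by dsimp only; omega),
            mul_simple_apply_of_ne _ _ _ (by dsimp only; omega) (by dsimp only; omega)])) rfl
        rw [e1, e2, heckeWord_snoc, heckeWord_snoc, mul_assoc, mul_assoc, heckeSucc_comm h]
      · have h : i.val + 1 = j.val := by omega
        obtain ⟨i, hi'⟩ := i
        obtain ⟨j, hj'⟩ := j
        dsimp only at h
        subst h
        set s : Equiv.Perm (Fin n) := simpleTransposition ⟨i, hi'⟩ with hs
        set t : Equiv.Perm (Fin n) := simpleTransposition ⟨i + 1, hj'⟩ with ht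
        have hbr : s * t * s = t * s * t := simpleTransposition_braid rfl
        -- the values of `w` at the positions `i`, `i + 1`, `i + 2` are decreasing
        have hs0 : ∀ v : Equiv.Perm (Fin n), (v * s) ⟨i, by omega⟩ = v ⟨i + 1, by omega⟩ :=
          fun v => mul_simple_apply_left v ⟨i, hi'⟩
        have hs1 : ∀ v : Equiv.Perm (Fin n), (v * s) ⟨i + 1, by omega⟩ = v ⟨i, by omega⟩ :=
          fun v => mul_simple_apply_right v ⟨i, hi'⟩
        have hs2 : ∀ v : Equiv.Perm (Fin n), (v * s) ⟨i + 1 + 1, by omega⟩ =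
            v ⟨i + 1 + 1, by omega⟩ :=
          fun v => mul_simple_apply_of_ne v ⟨i, hi'⟩ _ (by dsimp only; omega) (by dsimp only; omega)
        have ht0 : ∀ v : Equiv.Perm (Fin n), (v * t) ⟨i, by omega⟩ = v ⟨i, by omega⟩ :=
          fun v => mul_simple_apply_of_ne v ⟨i + 1, hj'⟩ _ (by dsimp only; omega)
            (by dsimp only; omega)
        have ht1 : ∀ v : Equiv.Perm (Fin n), (v * t) ⟨i + 1, by omega⟩ =
            v ⟨i + 1 + 1, by omega⟩ := fun v => mul_simple_apply_left v ⟨i + 1, hj'⟩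
        have ht2 : ∀ v : Equiv.Perm (Fin n), (v * t) ⟨i + 1 + 1, by omega⟩ =
            v ⟨i + 1, by omega⟩ := fun v => mul_simple_apply_right v ⟨i + 1, hj'⟩
        dsimp only at hi hj
        obtain ⟨c, hc⟩ := exists_isReducedWord (w * s * t * s)
        have hc' : IsReducedWord (w * t * s * t) c := by
          have : w * t * s * t = w * s * t * s := by simp only [mul_assoc] at hbr ⊢; rw [hbr]
          rwa [this]
        have d1 : IsReducedWord (w * s * t) (c ++ [⟨i, hi'⟩]) :=
          hc.snoc (by dsimp only; rw [ht0, ht1, hs0, hs2]; exact hj)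
        have d2 : IsReducedWord (w * s) (c ++ [⟨i, hi'⟩] ++ [⟨i + 1, hj'⟩]) :=
          d1.snoc (by dsimp only; rw [hs1, hs2]; exact hj.trans hi)
        have d3 : IsReducedWord (w * t * s) (c ++ [⟨i + 1, hj'⟩]) :=
          hc'.snoc (by dsimp only; rw [hs1, hs2, ht0, ht2]; exact hi)
        have d4 : IsReducedWord (w * t) (c ++ [⟨i + 1, hj'⟩] ++ [⟨i, hi'⟩]) :=
          d3.snoc (by dsimp only; rw [ht0, ht1]; exact hj.trans hi)
        have e1 := ih _ (by omega) ha d2 rfl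
        have e2 := ih _ (by omega) hb d4 rfl
        rw [e1, e2]
        simp only [heckeWord_snoc, mul_assoc]
        have := heckeSucc_braid i
        simp only [mul_assoc] at this
        rw [this]
    rcases lt_trichotomy i.val j.val with h | h | h
    · exact main i j a b h ha hb hi hj
    · have h' : i = j := Fin.ext h
      subst h'
      rw [ih _ (by omega) ha hb rfl]
    · exact (main j i b a h hb ha hj hi).symm

theorem IsReducedWord.heckeWord_eq_heckeOfPerm {n : ℕ} {w : Equiv.Perm (Fin n)}
    {l : List (Fin (n - 1))} (hl : IsReducedWord w l) : heckeWord l = heckeOfPerm w :=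
  hl.heckeWord_eq (exists_isReducedWord w).choose_spec

/-- The Demazure action of `s_{k+1}` on permutations: it exchanges the values at the neighbouring
positions `k` and `k + 1` if they are increasing, and changes nothing otherwise. -/
def demazureStep {n : ℕ} (σ : Equiv.Perm (Fin n)) (k : Fin (n - 1)) : Equiv.Perm (Fin n) :=
  if σ ⟨k.val, by omega⟩ < σ ⟨k.val + 1, by omega⟩ then σ * simpleTransposition k else σ

theorem heckeOfPerm_mul_heckeSucc {n : ℕ} (w : Equiv.Perm (Fin n)) (k : Fin (n - 1)) :
    heckeOfPerm w * heckeSucc k = heckeOfPerm (demazureStep w k) := by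
  unfold demazureStep
  rcases lt_or_gt_simple w k with h | h
  · rw [if_pos h]
    obtain ⟨l, hl⟩ := exists_isReducedWord w
    have hl' : IsReducedWord (w * simpleTransposition k) (l ++ [k]) :=
      IsReducedWord.snoc (by rwa [mul_simple_mul_simple])
        (by rwa [mul_simple_apply_left, mul_simple_apply_right])
    rw [← hl'.heckeWord_eq_heckeOfPerm, ← hl.heckeWord_eq_heckeOfPerm, heckeWord_snoc]
  · rw [if_neg h.not_gt]
    obtain ⟨l, hl⟩ := exists_isReducedWord (w * simpleTransposition k)
    rw [← (hl.snoc h).heckeWord_eq_heckeOfPerm, heckeWord_snoc, mul_assoc, heckeSucc_idem]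

theorem exists_heckeWord_eq_heckeOfPerm {n : ℕ} (l : List (Fin (n - 1))) :
    ∃ w : Equiv.Perm (Fin n), heckeWord l = heckeOfPerm w := by
  induction l using List.reverseRecOn with
  | nil => exact ⟨1, (isReducedWord_nil_iff.2 rfl).heckeWord_eq_heckeOfPerm⟩
  | append_singleton l k ih =>
    obtain ⟨w, hw⟩ := ih
    exact ⟨_, by rw [heckeWord_snoc, hw, heckeOfPerm_mul_heckeSucc]⟩

theorem demazureStep_apply {n : ℕ} (σ : Equiv.Perm (Fin n)) (k : Fin (n - 1)) (p : Fin n) :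
    demazureStep σ k p =
      if p.val = k.val then max (σ ⟨k.val, by omega⟩) (σ ⟨k.val + 1, by omega⟩)
      else if p.val = k.val + 1 then min (σ ⟨k.val, by omega⟩) (σ ⟨k.val + 1, by omega⟩)
      else σ p := by
  obtain ⟨p, hp⟩ := p
  dsimp only
  unfold demazureStep
  split_ifs with h h1 h2 h1 h2
  · subst h1; rw [max_eq_right h.le, mul_simple_apply_left]
  · subst h2; rw [min_eq_left h.le, mul_simple_apply_right]
  · exact mul_simple_apply_of_ne _ _ _ h1 h2
  · subst h1; rw [max_eq_left (not_lt.1 h)]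
  · subst h2; rw [min_eq_right (not_lt.1 h)]
  · rfl

theorem demazureStep_idem {n : ℕ} (σ : Equiv.Perm (Fin n)) (k : Fin (n - 1)) :
    demazureStep (demazureStep σ k) k = demazureStep σ k := by
  ext p
  simp only [demazureStep_apply]
  split_ifs <;> simp_all

theorem demazureStep_comm {n : ℕ} (σ : Equiv.Perm (Fin n)) {i j : Fin (n - 1)}
    (h : i.val + 1 < j.val) :
    demazureStep (demazureStep σ i) j = demazureStep (demazureStep σ j) i := by
  have h1 : i.val ≠ j.val := by omega
  have h2 : i.val ≠ j.val + 1 := by omega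
  have h3 : i.val + 1 ≠ j.val := by omega
  have h4 : i.val + 1 ≠ j.val + 1 := by omega
  ext p
  simp only [demazureStep_apply, h1, h2, h3, h4, h1.symm, h2.symm, h3.symm, h4.symm, if_false]
  split_ifs <;> first | rfl | omega

theorem demazureStep_braid {n : ℕ} (σ : Equiv.Perm (Fin n)) {i j : Fin (n - 1)}
    (h : i.val + 1 = j.val) :
    demazureStep (demazureStep (demazureStep σ i) j) i =
      demazureStep (demazureStep (demazureStep σ j) i) j := by
  obtain ⟨i, hi⟩ := i
  obtain ⟨j, hj⟩ := j
  dsimp only at h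
  subst h
  ext p
  simp only [demazureStep_apply]
  generalize σ ⟨i, _⟩ = a
  generalize σ ⟨i + 1, _⟩ = b
  generalize σ ⟨i + 1 + 1, _⟩ = c
  have e1 : i + 1 + 1 ≠ i := by omega
  have e2 : i ≠ i + 1 := by omega
  have e3 : i ≠ i + 1 + 1 := by omega
  have e4 : i + 1 + 1 ≠ i + 1 := by omega
  simp only [e1, e2, e3, e4, e2.symm, e4.symm, if_true, if_false]
  congr 1
  split_ifs <;> grind

/-! ### The Yang–Baxter equation -/

section YangBaxter

variable {R A : Type*} [CommRing R] [Ring A] [Algebra R A]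

/-- Elements `t 0, t 1, …` of a ring satisfying the relations of the degenerate Hecke algebra, where
`t k = 0` for all `k ≥ N`. -/
structure IsDegenerateHecke (N : ℕ) (t : ℕ → A) : Prop where
  idem : ∀ i, t i * t i = t i
  comm : ∀ i j, i + 1 < j → t i * t j = t j * t i
  braid : ∀ i, t i * t (i + 1) * t i = t (i + 1) * t i * t (i + 1)
  vanish : ∀ i, N ≤ i → t i = 0

/-- The factor `1 - x t_k`. -/
def hFactor (t : ℕ → A) (x : R) (k : ℕ) : A := 1 - x • t k

/-- The product `(1 - x t_{N-1}) ⋯ (1 - x t_{i+1}) (1 - x t_i)`. -/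
def descProd (N : ℕ) (t : ℕ → A) (i : ℕ) (x : R) : A :=
  ((List.range' i (N - i)).reverse.map (hFactor t x)).prod

/-- The product `(1 - y t_i) (1 - y t_{i+1}) ⋯ (1 - y t_{N-1})`. -/
def ascProd (N : ℕ) (t : ℕ → A) (i : ℕ) (y : R) : A :=
  ((List.range' i (N - i)).map (hFactor t y)).prod

variable {N : ℕ} {t : ℕ → A} (ht : IsDegenerateHecke N t)

theorem descProd_of_le {i : ℕ} (h : N ≤ i) (x : R) : descProd N t i x = 1 := by
  simp [descProd, Nat.sub_eq_zero_of_le h]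

theorem ascProd_of_le {i : ℕ} (h : N ≤ i) (x : R) : ascProd N t i x = 1 := by
  simp [ascProd, Nat.sub_eq_zero_of_le h]

include ht

theorem IsDegenerateHecke.hFactor_of_le {k : ℕ} (h : N ≤ k) (x : R) : hFactor t x k = 1 := by
  simp [hFactor, ht.vanish k h]

theorem IsDegenerateHecke.descProd_eq (i : ℕ) (x : R) :
    descProd N t i x = descProd N t (i + 1) x * hFactor t x i := by
  rcases Nat.lt_or_ge i N with h | h
  · unfold descProd
    rw [show N - i = N - (i + 1) + 1 by omega, List.range'_succ]
    simp
  · rw [descProd_of_le h, descProd_of_le (by omega), ht.hFactor_of_le h, one_mul]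

theorem IsDegenerateHecke.ascProd_eq (i : ℕ) (y : R) :
    ascProd N t i y = hFactor t y i * ascProd N t (i + 1) y := by
  rcases Nat.lt_or_ge i N with h | h
  · unfold ascProd
    rw [show N - i = N - (i + 1) + 1 by omega, List.range'_succ]
    simp
  · rw [ascProd_of_le h, ascProd_of_le (by omega), ht.hFactor_of_le h, one_mul]

theorem IsDegenerateHecke.commute_hFactor (x y : R) {i j : ℕ} (h : i + 1 < j) :
    Commute (hFactor t x i) (hFactor t y j) := by
  have : Commute (t i) (t j) := ht.comm i j h
  exact ((Commute.one_left _).sub_left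
    (((Commute.one_right _).sub_right (this.smul_right y)).smul_left x))

theorem IsDegenerateHecke.commute_hFactor_descProd (x y : R) {i j : ℕ} (h : i + 1 < j) :
    Commute (hFactor t x i) (descProd N t j y) := by
  apply Commute.list_prod_right
  intro z hz
  simp only [List.mem_map, List.mem_reverse, List.mem_range'_1] at hz
  obtain ⟨k, hk, rfl⟩ := hz
  exact ht.commute_hFactor x y (by omega)

theorem IsDegenerateHecke.commute_hFactor_ascProd (x y : R) {i j : ℕ} (h : i + 1 < j) :
    Commute (hFactor t x i) (ascProd N t j y) := by
  apply Commute.list_prod_right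
  intro z hz
  simp only [List.mem_map, List.mem_range'_1] at hz
  obtain ⟨k, hk, rfl⟩ := hz
  exact ht.commute_hFactor x y (by omega)

/-- The Yang–Baxter equation for the factors `1 - x t_k`, with spectral parameters in the
multiplicative formal group `x + y - x y`. -/
theorem IsDegenerateHecke.yangBaxter (x y : R) (i : ℕ) :
    hFactor t y i * hFactor t (x + y - x * y) (i + 1) * hFactor t x i =
      hFactor t x (i + 1) * hFactor t (x + y - x * y) i * hFactor t y (i + 1) := by
  have ha := ht.idem i
  have hb := ht.idem (i + 1)
  have hab := ht.braid i
  unfold hFactor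
  generalize t i = a at *
  generalize t (i + 1) = b at *
  rw [mul_assoc, mul_assoc] at hab
  simp only [mul_sub, sub_mul, one_mul, mul_one, smul_mul_assoc, mul_smul_comm, mul_assoc, ha, hb,
    hab]
  module

/-- A form of the Yang–Baxter equation free of denominators: `1 - x + x t` is `1 - x` times the
inverse of `1 - x t`. -/
theorem IsDegenerateHecke.yangBaxter_inv (x y : R) (i : ℕ) :
    (1 - x) • (hFactor t x i * hFactor t y (i + 1) * hFactor t y i) =
      hFactor t y (i + 1) * ((1 - x) • 1 + x • t (i + 1)) * hFactor t y i * hFactor t x (i + 1) *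
        hFactor t x i := by
  have ha := ht.idem i
  have hb := ht.idem (i + 1)
  have hab := ht.braid i
  unfold hFactor
  generalize t i = a at *
  generalize t (i + 1) = b at *
  rw [mul_assoc, mul_assoc] at hab
  simp only [mul_sub, sub_mul, mul_add, add_mul, one_mul, mul_one, smul_mul_assoc, mul_smul_comm,
    mul_assoc, ha, hb, ← hab]
  module

theorem IsDegenerateHecke.hFactor_mul_inv (x : R) (k : ℕ) :
    hFactor t x k * ((1 - x) • 1 + x • t k) = (1 - x) • 1 := by
  simp only [hFactor, sub_mul, mul_add, one_mul, mul_one, smul_mul_assoc, mul_smul_comm, ht.idem]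
  module

/-- The products `A_i(x)` and `A_i(y)` commute: the descending induction moves a factor
`(1 - y t_{i+1}) (1 - x t_{i+1})⁻¹` through the Yang–Baxter equation. The denominators are cleared
with `1 - x`, which has to be regular. -/
theorem IsDegenerateHecke.descProd_comm (x y : R) (hx : IsSMulRegular A (1 - x)) (i : ℕ) :
    descProd N t i x * descProd N t i y = descProd N t i y * descProd N t i x := by
  induction hk : N - i generalizing i with
  | zero => simp [descProd_of_le (show N ≤ i by omega)]
  | succ k ih =>
    apply hx
    have ih := ih (i + 1) (by omega)
    have c := fun z : R => (ht.commute_hFactor_descProd z y (i := i) (j := i + 2) (by omega)).eq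
    have c' := fun z : R => (ht.commute_hFactor_descProd z x (i := i) (j := i + 2) (by omega)).eq
    calc (1 - x) • (descProd N t i x * descProd N t i y)
        = (1 - x) • (descProd N t (i + 1) x * (hFactor t x i * descProd N t (i + 2) y) *
            hFactor t y (i + 1) * hFactor t y i) := by
          rw [ht.descProd_eq i x, ht.descProd_eq i y, ht.descProd_eq (i + 1) y]
          simp only [mul_assoc]
      _ = descProd N t (i + 1) x * descProd N t (i + 2) y *
            ((1 - x) • (hFactor t x i * hFactor t y (i + 1) * hFactor t y i)) := by
          rw [c, mul_smul_comm]
          simp only [mul_assoc]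
      _ = descProd N t (i + 1) x * descProd N t (i + 1) y *
            ((1 - x) • 1 + x • t (i + 1)) * hFactor t y i * hFactor t x (i + 1) *
              hFactor t x i := by
          rw [ht.yangBaxter_inv, ht.descProd_eq (i + 1) y]
          simp only [mul_assoc]
      _ = descProd N t (i + 1) y * descProd N t (i + 2) x *
            (hFactor t x (i + 1) * ((1 - x) • 1 + x • t (i + 1))) * hFactor t y i *
              hFactor t x (i + 1) * hFactor t x i := by
          rw [ih, ht.descProd_eq (i + 1) x]
          simp only [mul_assoc]
      _ = (1 - x) • (descProd N t (i + 1) y * (descProd N t (i + 2) x * hFactor t y i) *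
            hFactor t x (i + 1) * hFactor t x i) := by
          rw [ht.hFactor_mul_inv]
          simp only [mul_smul_comm, smul_mul_assoc, mul_one, mul_assoc]
      _ = (1 - x) • (descProd N t i y * descProd N t i x) := by
          rw [← c', ht.descProd_eq i x, ht.descProd_eq i y, ht.descProd_eq (i + 1) x]
          simp only [mul_assoc]

/-- The exchange relation `B_i(y) A_i(x) = A_{i+1}(x) (1 - (x + y - x y) t_i) B_{i+1}(y)`. -/
theorem IsDegenerateHecke.ascProd_mul_descProd (x y : R) (i : ℕ) :
    ascProd N t i y * descProd N t i x =
      descProd N t (i + 1) x * hFactor t (x + y - x * y) i * ascProd N t (i + 1) y := by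
  induction hk : N - i generalizing i with
  | zero =>
    have h : N ≤ i := by omega
    rw [ascProd_of_le h, descProd_of_le h, descProd_of_le (by omega),
      ascProd_of_le (by omega), ht.hFactor_of_le h, one_mul, one_mul]
  | succ k ih =>
    have ih := ih (i + 1) (by omega)
    have c := (ht.commute_hFactor_descProd y x (i := i) (j := i + 2) (by omega)).eq
    have c' := (ht.commute_hFactor_ascProd x y (i := i) (j := i + 2) (by omega)).eq
    calc ascProd N t i y * descProd N t i x
        = hFactor t y i * (ascProd N t (i + 1) y * descProd N t (i + 1) x) * hFactor t x i := by
          rw [ht.descProd_eq i, ht.ascProd_eq i]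
          simp only [mul_assoc]
      _ = (hFactor t y i * descProd N t (i + 2) x) * hFactor t (x + y - x * y) (i + 1) *
            (ascProd N t (i + 2) y * hFactor t x i) := by
          rw [ih]
          simp only [mul_assoc]
      _ = descProd N t (i + 2) x * (hFactor t y i * hFactor t (x + y - x * y) (i + 1) *
            hFactor t x i) * ascProd N t (i + 2) y := by
          rw [c, ← c']
          simp only [mul_assoc]
      _ = _ := by
          rw [ht.yangBaxter, ht.descProd_eq (i + 1), ht.ascProd_eq (i + 1)]
          simp only [mul_assoc]

omit ht

/-- The product `A_0(ξ_0) A_1(ξ_1) ⋯ A_{m-1}(ξ_{m-1})`, shifted by `j`: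
`A_i(x) = (1 - x t_{N-1}) ⋯ (1 - x t_i)` and the `i`-th factor is `A_{j+i}(ξ_i)`. -/
def descChain (N : ℕ) (t : ℕ → A) (ξ : ℕ → R) (j m : ℕ) : A :=
  ((List.range m).map fun i => descProd N t (j + i) (ξ i)).prod

/-- The product `B_{N-1}(ψ_{N-1}) B_{N-2}(ψ_{N-2}) ⋯` of `m` factors, where
`B_i(y) = (1 - y t_i) ⋯ (1 - y t_{N-1})`. -/
def ascChain (N : ℕ) (t : ℕ → A) (ψ : ℕ → R) (m : ℕ) : A :=
  ((List.range m).map fun i => ascProd N t (N - 1 - i) (ψ (N - 1 - i))).prod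

/-- The Fomin–Kirillov product
`B_{N-1}(ψ_{N-1}) ⋯ B_0(ψ_0) A_0(ξ_0) ⋯ A_{N-1}(ξ_{N-1})`, the generating function of the double
Grothendieck polynomials. -/
def fominKirillov (N : ℕ) (t : ℕ → A) (ξ ψ : ℕ → R) : A :=
  ascChain N t ψ N * descChain N t ξ 0 N

theorem descChain_succ (ξ : ℕ → R) (j m : ℕ) :
    descChain N t ξ j (m + 1) = descChain N t ξ j m * descProd N t (j + m) (ξ m) :=
  List.prod_range_succ _ _

theorem ascChain_succ (ψ : ℕ → R) (m : ℕ) :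
    ascChain N t ψ (m + 1) = ascChain N t ψ m * ascProd N t (N - 1 - m) (ψ (N - 1 - m)) :=
  List.prod_range_succ _ _

theorem descChain_of_le (ξ : ℕ → R) (j : ℕ) {m : ℕ} (h : N ≤ j + m) (k : ℕ) :
    descChain N t ξ j (m + k) = descChain N t ξ j m := by
  induction k with
  | zero => rfl
  | succ k ih => rw [← add_assoc, descChain_succ, ih, descProd_of_le (by omega), mul_one]

theorem descChain_congr {ξ ξ' : ℕ → R} (j : ℕ) {m : ℕ} (h : ∀ i < m, ξ i = ξ' i) :
    descChain N t ξ j m = descChain N t ξ' j m := by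
  unfold descChain
  congr 1
  apply List.map_congr_left
  intro i hi
  rw [h i (List.mem_range.1 hi)]

theorem descChain_add (ξ : ℕ → R) (j m k : ℕ) :
    descChain N t ξ j (m + k) =
      descChain N t ξ j m * descChain N t (fun i => ξ (m + i)) (j + m) k := by
  induction k with
  | zero => simp [descChain]
  | succ k ih => rw [← add_assoc, descChain_succ, ih, descChain_succ, mul_assoc, add_assoc]

include ht

theorem IsDegenerateHecke.commute_hFactor_descChain (x : R) (ξ : ℕ → R) {i j : ℕ} (m : ℕ)
    (h : i + 1 < j) : Commute (hFactor t x i) (descChain N t ξ j m) := by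
  apply Commute.list_prod_right
  intro z hz
  simp only [List.mem_map] at hz
  obtain ⟨k, hk, rfl⟩ := hz
  exact ht.commute_hFactor_descProd x _ (by omega)

/-- The factor `1 - ξ_{i+1} t_i` commutes with the `A_k`, `k ≥ i + 2`, and completes
`A_{i+1}(ξ_{i+1})` to `A_i(ξ_{i+1})`. -/
theorem IsDegenerateHecke.fominKirillov_mul_hFactor (ξ ψ : ℕ → R) {i : ℕ} (hi : i < N) :
    fominKirillov N t ξ ψ * hFactor t (ξ (i + 1)) i =
      ascChain N t ψ N * descChain N t ξ 0 i *
        (descProd N t i (ξ i) * descProd N t i (ξ (i + 1))) *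
          descChain N t (fun k => ξ (i + 2 + k)) (i + 2) (N - (i + 1)) := by
  unfold fominKirillov
  rw [← descChain_of_le ξ 0 (m := N) (by omega) 1, show N + 1 = i + 2 + (N - (i + 1)) by omega,
    descChain_add, zero_add, descChain_succ, descChain_succ, zero_add, zero_add,
    ht.descProd_eq i (ξ (i + 1))]
  have := (ht.commute_hFactor_descChain (ξ (i + 1)) (fun k => ξ (i + 2 + k)) (i := i)
    (j := i + 2) (N - (i + 1)) (by omega)).eq
  simp only [mul_assoc, this]

/-- The product `𝔊 · (1 - ξ_{i+1} t_i)` is symmetric in `ξ_i` and `ξ_{i+1}`. Comparing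
coefficients, this is the recursion of the Grothendieck polynomials. -/
theorem IsDegenerateHecke.fominKirillov_symm (ξ ψ : ℕ → R) {i : ℕ} (hi : i < N)
    (hx : IsSMulRegular A (1 - ξ i)) :
    fominKirillov N t ξ ψ * hFactor t (ξ (i + 1)) i =
      fominKirillov N t (ξ ∘ Equiv.swap i (i + 1)) ψ * hFactor t (ξ i) i := by
  have e : (ξ ∘ Equiv.swap i (i + 1)) (i + 1) = ξ i := by simp
  have e' : (ξ ∘ Equiv.swap i (i + 1)) i = ξ (i + 1) := by simp
  rw [← e, ht.fominKirillov_mul_hFactor ξ ψ hi, ht.fominKirillov_mul_hFactor _ ψ hi, e, e',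
    ht.descProd_comm _ _ hx]
  congr 2
  · congr 1
    apply descChain_congr
    intro k hk
    rw [Function.comp_apply, Equiv.swap_apply_of_ne_of_ne (by omega) (by omega)]
  · funext k
    rw [Function.comp_apply, Equiv.swap_apply_of_ne_of_ne (by omega) (by omega)]

/-- Moving `B_j(y)` through a whole chain of `A`s by the exchange relation. -/
theorem IsDegenerateHecke.ascProd_mul_descChain (y : R) (ξ : ℕ → R) (j m : ℕ) :
    ascProd N t j y * descChain N t ξ j m =
      descChain N t ξ (j + 1) m *
        ((List.range m).map fun i => hFactor t (ξ i + y - ξ i * y) (j + i)).prod *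
          ascProd N t (j + m) y := by
  induction m with
  | zero => simp [descChain]
  | succ m ih =>
    rw [descChain_succ, ← mul_assoc, ih, mul_assoc, ht.ascProd_mul_descProd, descChain_succ,
      List.prod_range_succ]
    have : Commute ((List.range m).map fun i => hFactor t (ξ i + y - ξ i * y) (j + i)).prod
        (descProd N t (j + m + 1) (ξ m)) := by
      apply Commute.list_prod_left
      intro z hz
      simp only [List.mem_map, List.mem_range] at hz
      obtain ⟨k, hk, rfl⟩ := hz
      exact ht.commute_hFactor_descProd _ _ (by omega)
    rw [show j + 1 + m = j + m + 1 by omega]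
    have e := this.eq
    simp only [mul_assoc] at e ⊢
    rw [← mul_assoc _ (descProd N t (j + m + 1) (ξ m)), e]
    simp only [mul_assoc, add_assoc]

/-- The Fomin–Kirillov product is a product of `N (N + 1) / 2` factors with spectral parameters
`ξ_i + ψ_j - ξ_i ψ_j`, `i + j < N`. -/
theorem IsDegenerateHecke.fominKirillov_eq (ξ ψ : ℕ → R) :
    fominKirillov N t ξ ψ = ((List.range N).map fun p => ((List.range (p + 1)).map fun i =>
      hFactor t (ξ i + ψ (N - 1 - p) - ξ i * ψ (N - 1 - p)) (N - 1 - p + i)).prod).prod := by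
  have key : ∀ k ≤ N, ascChain N t ψ k * descChain N t ξ (N - k) k =
      ((List.range k).map fun p => ((List.range (p + 1)).map fun i =>
        hFactor t (ξ i + ψ (N - 1 - p) - ξ i * ψ (N - 1 - p)) (N - 1 - p + i)).prod).prod := by
    intro k hk
    induction k with
    | zero => simp [ascChain, descChain]
    | succ k ih =>
      rw [List.prod_range_succ, ← ih (by omega), ascChain_succ, mul_assoc,
        show N - (k + 1) = N - 1 - k by omega, ht.ascProd_mul_descChain,
        ascProd_of_le (show N ≤ N - 1 - k + (k + 1) by omega), mul_one,
        show N - 1 - k + 1 = N - k by omega, descChain_of_le ξ (N - k) (by omega) 1, mul_assoc]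
  have := key N le_rfl
  rwa [Nat.sub_self] at this

end YangBaxter

/-! ### The matrix representation of the degenerate Hecke algebra -/

section MatrixRepresentation

variable {R S : Type*} [CommRing R] [CommRing S]

/-- The `0`-`1` matrix of a map `f`: it sends the row vector of `σ` to that of `f σ`. -/
def funMatrix (R : Type*) [CommRing R] {α : Type*} [DecidableEq α] (f : α → α) : Matrix α α R :=
  fun σ τ => if f σ = τ then 1 else 0

theorem funMatrix_mul_funMatrix {α : Type*} [Fintype α] [DecidableEq α] (f g : α → α) :
    funMatrix R f * funMatrix R g = funMatrix R (g ∘ f) := by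
  ext σ τ
  simp only [Matrix.mul_apply, funMatrix, Function.comp_apply]
  rw [Finset.sum_eq_single (f σ)] <;> simp +contextual [eq_comm]

/-- The matrix by which the generator `s_{k+1}` acts on permutations of `n` letters: the Demazure
action if `s_{k+1} ∈ S_n`, and zero otherwise. -/
def heckeMatrix (R : Type*) [CommRing R] (n k : ℕ) :
    Matrix (Equiv.Perm (Fin n)) (Equiv.Perm (Fin n)) R :=
  if h : k < n - 1 then funMatrix R fun σ => demazureStep σ ⟨k, h⟩ else 0

theorem heckeMatrix_of_lt {n k : ℕ} (h : k < n - 1) :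
    heckeMatrix R n k = funMatrix R fun σ => demazureStep σ ⟨k, h⟩ := dif_pos h

theorem heckeMatrix_of_le {n k : ℕ} (h : n - 1 ≤ k) : heckeMatrix R n k = 0 := dif_neg h.not_gt

theorem isDegenerateHecke_heckeMatrix (R : Type*) [CommRing R] (n : ℕ) :
    IsDegenerateHecke (n - 1) (heckeMatrix R n) where
  idem i := by
    rcases Nat.lt_or_ge i (n - 1) with h | h
    · rw [heckeMatrix_of_lt h, funMatrix_mul_funMatrix]
      congr 1
      funext σ
      exact demazureStep_idem σ _
    · rw [heckeMatrix_of_le h, mul_zero]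
  comm i j hij := by
    rcases Nat.lt_or_ge j (n - 1) with h | h
    · rw [heckeMatrix_of_lt h, heckeMatrix_of_lt (show i < n - 1 by omega),
        funMatrix_mul_funMatrix, funMatrix_mul_funMatrix]
      congr 1
      funext σ
      exact demazureStep_comm σ hij
    · rw [heckeMatrix_of_le h, mul_zero, zero_mul]
  braid i := by
    rcases Nat.lt_or_ge (i + 1) (n - 1) with h | h
    · rw [heckeMatrix_of_lt h, heckeMatrix_of_lt (show i < n - 1 by omega),
        funMatrix_mul_funMatrix, funMatrix_mul_funMatrix, funMatrix_mul_funMatrix,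
        funMatrix_mul_funMatrix]
      congr 1
      funext σ
      exact demazureStep_braid σ rfl
    · rw [heckeMatrix_of_le h, mul_zero, zero_mul, zero_mul]
  vanish i h := heckeMatrix_of_le h

theorem mul_heckeMatrix_apply {n k : ℕ} (h : k < n - 1)
    (M : Matrix (Equiv.Perm (Fin n)) (Equiv.Perm (Fin n)) R) (σ τ : Equiv.Perm (Fin n)) :
    (M * heckeMatrix R n k) σ τ = ∑ ρ, if demazureStep ρ ⟨k, h⟩ = τ then M σ ρ else 0 := by
  simp [heckeMatrix_of_lt h, Matrix.mul_apply, funMatrix]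

/-- The representation of the degenerate Hecke algebra by the matrices `heckeMatrix`. -/
noncomputable def heckeRep (n : ℕ) :
    DegenerateHecke →ₐ[ℤ] Matrix (Equiv.Perm (Fin n)) (Equiv.Perm (Fin n)) ℤ :=
  RingQuot.liftAlgHom ℤ ⟨FreeAlgebra.lift ℤ fun i : ℕ+ => heckeMatrix ℤ n i.natPred, by
    have H := isDegenerateHecke_heckeMatrix ℤ n
    intro x y hxy
    induction hxy with
    | idem i => simpa using H.idem _
    | comm i j h =>
      simp only [map_mul, FreeAlgebra.lift_ι_apply]
      have hi := i.natPred_add_one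
      have hj := j.natPred_add_one
      rcases lt_abs.1 h with h | h
      · exact (H.comm _ _ (by omega)).symm
      · exact H.comm _ _ (by omega)
    | braid i =>
      have e : (i + 1).natPred = i.natPred + 1 := by
        have hi := i.natPred_add_one
        have hj := (i + 1).natPred_add_one
        rw [PNat.add_coe, PNat.one_coe] at hj
        omega
      simpa [e] using H.braid i.natPred⟩

theorem heckeRep_heckeSucc (n k : ℕ) : heckeRep n (heckeSucc k) = heckeMatrix ℤ n k := by
  unfold heckeRep heckeSucc heckeGen
  rw [RingQuot.liftAlgHom_mkAlgHom_apply, FreeAlgebra.lift_ι_apply, Nat.natPred_succPNat]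

theorem heckeRep_prod (n : ℕ) (l : List ℕ) :
    heckeRep n (l.map heckeSucc).prod = (l.map (heckeMatrix ℤ n)).prod := by
  rw [map_list_prod, List.map_map]
  congr 2
  funext k
  exact heckeRep_heckeSucc n k

theorem heckeRep_heckeWord {n : ℕ} {w : Equiv.Perm (Fin n)} {l : List (Fin (n - 1))}
    (hl : IsReducedWord w l) (τ : Equiv.Perm (Fin n)) :
    heckeRep n (heckeWord l) 1 τ = if w = τ then 1 else 0 := by
  induction l using List.reverseRecOn generalizing w τ with
  | nil =>
    rw [isReducedWord_nil_iff.1 hl]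
    simp [heckeWord, Matrix.one_apply]
  | append_singleton l k ih =>
    obtain ⟨h1, h2⟩ := hl.of_snoc
    have e : demazureStep (w * simpleTransposition k) k = w := by
      unfold demazureStep
      rw [if_pos (by rwa [mul_simple_apply_left, mul_simple_apply_right]), mul_simple_mul_simple]
    rw [heckeWord_snoc, map_mul, heckeRep_heckeSucc, mul_heckeMatrix_apply k.2]
    rw [Finset.sum_eq_single (w * simpleTransposition k)]
    · simp [ih h1, e]
    · intro ρ _ hρ
      simp [ih h1, hρ.symm]
    · simp

/-- The first row of the matrix of a permutation `w` is the unit vector at `w`; in particular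
distinct permutations are distinct elements of the degenerate Hecke algebra. -/
theorem heckeRep_heckeOfPerm {n : ℕ} (w τ : Equiv.Perm (Fin n)) :
    heckeRep n (heckeOfPerm w) 1 τ = if w = τ then 1 else 0 := by
  obtain ⟨l, hl⟩ := exists_isReducedWord w
  rw [← hl.heckeWord_eq_heckeOfPerm, heckeRep_heckeWord hl]

/-- The generators outside `S_n` act by zero, so none of them occurs in a factorization of a
permutation in `S_n`. -/
theorem lt_of_prod_heckeSucc_eq {n : ℕ} {w : Equiv.Perm (Fin n)} {l : List ℕ}
    (h : (l.map heckeSucc).prod = heckeOfPerm w) {k : ℕ} (hk : k ∈ l) : k < n - 1 := by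
  by_contra hc
  have h1 := heckeRep_heckeOfPerm w w
  rw [← h, heckeRep_prod, List.prod_eq_zero] at h1
  · simp at h1
  · exact List.mem_map.2 ⟨k, hk, heckeMatrix_of_le (not_lt.1 hc)⟩

/-- The entries of the first row of the product along a word detect the element of the degenerate
Hecke algebra which the word represents. -/
theorem prod_heckeMatrix_apply {n : ℕ} (w : Equiv.Perm (Fin n)) (l : List ℕ)
    [Decidable ((l.map heckeSucc).prod = heckeOfPerm w)] :
    (l.map (heckeMatrix ℤ n)).prod 1 w =
      if (l.map heckeSucc).prod = heckeOfPerm w then 1 else 0 := by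
  rw [← heckeRep_prod]
  by_cases hl : ∀ k ∈ l, k < n - 1
  · obtain ⟨l, rfl⟩ : ∃ l' : List (Fin (n - 1)), l'.map Fin.val = l :=
      ⟨l.pmap (fun k hk => ⟨k, hk⟩) hl, by simp [List.map_pmap]⟩
    obtain ⟨v, hv⟩ := exists_heckeWord_eq_heckeOfPerm l
    have hv' : ((l.map Fin.val).map heckeSucc).prod = heckeOfPerm v := by
      rw [← hv, heckeWord, List.map_map]
      rfl
    by_cases e : v = w
    · rw [if_pos (e ▸ hv'), hv', heckeRep_heckeOfPerm, if_pos e]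
    · have h0 : heckeRep n (heckeOfPerm v) 1 w = 0 := by rw [heckeRep_heckeOfPerm, if_neg e]
      rw [if_neg, hv', h0]
      intro e'
      rw [← hv', e', heckeRep_heckeOfPerm, if_pos rfl] at h0
      exact one_ne_zero h0
  · rw [if_neg fun h => hl fun k hk => lt_of_prod_heckeSucc_eq h hk]
    push Not at hl
    obtain ⟨k, hk, hk'⟩ := hl
    rw [heckeRep_prod, List.prod_eq_zero (List.mem_map.2 ⟨k, hk, heckeMatrix_of_le hk'⟩)]
    rfl

/-! ### Naturality -/

theorem map_heckeMatrix (φ : R →+* S) (n k : ℕ) :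
    φ.mapMatrix (heckeMatrix R n k) = heckeMatrix S n k := by
  unfold heckeMatrix
  split_ifs
  · ext σ τ
    simp [funMatrix, apply_ite φ]
  · simp

theorem map_hFactor (φ : R →+* S) (n : ℕ) (x : R) (k : ℕ) :
    φ.mapMatrix (hFactor (heckeMatrix R n) x k) = hFactor (heckeMatrix S n) (φ x) k := by
  unfold hFactor
  rw [← map_heckeMatrix φ, map_sub, map_one]
  congr 1
  ext σ τ
  simp

theorem map_descProd (φ : R →+* S) (n N i : ℕ) (x : R) :
    φ.mapMatrix (descProd N (heckeMatrix R n) i x) = descProd N (heckeMatrix S n) i (φ x) := by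
  unfold descProd
  rw [map_list_prod, List.map_map]
  congr 2
  funext k
  exact map_hFactor φ n x k

theorem map_ascProd (φ : R →+* S) (n N i : ℕ) (x : R) :
    φ.mapMatrix (ascProd N (heckeMatrix R n) i x) = ascProd N (heckeMatrix S n) i (φ x) := by
  unfold ascProd
  rw [map_list_prod, List.map_map]
  congr 2
  funext k
  exact map_hFactor φ n x k

theorem map_fominKirillov (φ : R →+* S) (n N : ℕ) (ξ ψ : ℕ → R) :
    φ.mapMatrix (fominKirillov N (heckeMatrix R n) ξ ψ) =
      fominKirillov N (heckeMatrix S n) (φ ∘ ξ) (φ ∘ ψ) := by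
  unfold fominKirillov ascChain descChain
  rw [map_mul, map_list_prod, map_list_prod, List.map_map, List.map_map]
  congr 3
  · funext k
    exact map_ascProd φ n N _ _
  · funext k
    exact map_descProd φ n N _ _

/-! ### The coefficient of the longest permutation -/

/-- `M` has no entry in its first row beyond the length of `w`, and its entry at `w` is `c`, up to
the sign of `w`. -/
def IsTopEntry {n : ℕ} (M : Matrix (Equiv.Perm (Fin n)) (Equiv.Perm (Fin n)) R)
    (w : Equiv.Perm (Fin n)) (c : R) : Prop :=
  (∀ σ, permLength w < permLength σ → M 1 σ = 0) ∧ M 1 w = (-1) ^ permLength w * c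

theorem mul_hFactor_apply {n : ℕ} (M : Matrix (Equiv.Perm (Fin n)) (Equiv.Perm (Fin n)) R)
    (x : R) (k : ℕ) (σ τ : Equiv.Perm (Fin n)) :
    (M * hFactor (heckeMatrix R n) x k) σ τ = M σ τ - x * (M * heckeMatrix R n k) σ τ := by
  simp [hFactor, mul_sub]

theorem permLength_demazureStep_le {n : ℕ} (σ : Equiv.Perm (Fin n)) (k : Fin (n - 1)) :
    permLength (demazureStep σ k) ≤ permLength σ + 1 := by
  unfold demazureStep
  split_ifs
  · exact permLength_mul_simple_le σ k
  · omega

theorem demazureStep_eq_mul_simple_iff {n : ℕ} {w : Equiv.Perm (Fin n)} {k : Fin (n - 1)}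
    (hw : w ⟨k.val, by omega⟩ < w ⟨k.val + 1, by omega⟩) (ρ : Equiv.Perm (Fin n)) :
    demazureStep ρ k = w * simpleTransposition k ↔ ρ = w ∨ ρ = w * simpleTransposition k := by
  constructor
  · unfold demazureStep
    split_ifs
    · exact fun h => Or.inl (mul_right_cancel h)
    · exact Or.inr
  · rintro (rfl | rfl)
    · exact if_pos hw
    · exact if_neg (by rw [mul_simple_apply_left, mul_simple_apply_right]; exact hw.not_gt)

theorem demazureStep_ne_of_ascent {n : ℕ} {w : Equiv.Perm (Fin n)} {k : Fin (n - 1)}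
    (hw : w ⟨k.val, by omega⟩ < w ⟨k.val + 1, by omega⟩) (ρ : Equiv.Perm (Fin n)) :
    demazureStep ρ k ≠ w := by
  rintro rfl
  simp only [demazureStep_apply, if_true, Nat.succ_ne_self, if_false] at hw
  exact absurd hw (min_le_max.not_gt)

theorem mul_heckeMatrix_apply_of_ascent {n : ℕ} {w : Equiv.Perm (Fin n)} {k : Fin (n - 1)}
    (hw : w ⟨k.val, by omega⟩ < w ⟨k.val + 1, by omega⟩)
    (M : Matrix (Equiv.Perm (Fin n)) (Equiv.Perm (Fin n)) R) (σ : Equiv.Perm (Fin n)) :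
    (M * heckeMatrix R n k) σ w = 0 := by
  rw [mul_heckeMatrix_apply k.2]
  exact Finset.sum_eq_zero fun ρ _ => if_neg (demazureStep_ne_of_ascent hw ρ)

theorem mul_heckeMatrix_apply_mul_simple {n : ℕ} {w : Equiv.Perm (Fin n)} {k : Fin (n - 1)}
    (hw : w ⟨k.val, by omega⟩ < w ⟨k.val + 1, by omega⟩)
    (M : Matrix (Equiv.Perm (Fin n)) (Equiv.Perm (Fin n)) R) (σ : Equiv.Perm (Fin n)) :
    (M * heckeMatrix R n k) σ (w * simpleTransposition k) =
      M σ w + M σ (w * simpleTransposition k) := by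
  have hne : w ≠ w * simpleTransposition k := fun e => by
    have := permLength_mul_simple w k hw
    rw [← e] at this
    omega
  rw [mul_heckeMatrix_apply k.2, ← Finset.sum_filter]
  have : (Finset.univ.filter fun ρ => demazureStep ρ ⟨k.val, k.2⟩ = w * simpleTransposition k) =
      {w, w * simpleTransposition k} := by
    ext ρ
    simp [demazureStep_eq_mul_simple_iff hw]
  rw [this, Finset.sum_pair hne]

theorem IsTopEntry.mul_hFactor {n : ℕ} {M : Matrix (Equiv.Perm (Fin n)) (Equiv.Perm (Fin n)) R}
    {w : Equiv.Perm (Fin n)} {c : R} (h : IsTopEntry M w c) (k : Fin (n - 1)) (z : R)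
    (hw : w ⟨k.val, by omega⟩ < w ⟨k.val + 1, by omega⟩) :
    IsTopEntry (M * hFactor (heckeMatrix R n) z k) (w * simpleTransposition k) (c * z) := by
  have hl := permLength_mul_simple w k hw
  refine ⟨fun σ hσ => ?_, ?_⟩
  · rw [mul_hFactor_apply, h.1 σ (by omega), mul_heckeMatrix_apply k.2, Finset.sum_eq_zero,
      mul_zero, sub_zero]
    intro ρ _
    split_ifs with hρ
    · have := permLength_demazureStep_le ρ k
      exact h.1 ρ (by rw [hρ] at this; omega)
    · rfl
  · rw [mul_hFactor_apply, mul_heckeMatrix_apply_mul_simple hw, h.1 _ (by omega), h.2, hl]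
    ring

/-- One block of the factorization, with `N = n - 1`: the factors with indices `N - 1 - p, …, N - 1`
move the value at position `N - 1 - p` of `w` to the end. -/
theorem IsTopEntry.mul_block {n p : ℕ} (hp : p < n - 1)
    {M : Matrix (Equiv.Perm (Fin n)) (Equiv.Perm (Fin n)) R}
    {w : Equiv.Perm (Fin n)} {c : R} (h : IsTopEntry M w c) (z : ℕ → R)
    (hw : ∀ q : Fin n, (w q).val =
      if q.val < n - 1 - p then q.val else n - 1 - p + (n - 1) - q.val) (m : ℕ) (hm : m ≤ p + 1) :
    ∃ w' : Equiv.Perm (Fin n),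
      IsTopEntry (M * ((List.range m).map fun i =>
        hFactor (heckeMatrix R n) (z i) (n - 1 - 1 - p + i)).prod) w'
        (c * ∏ i ∈ Finset.range m, z i) ∧
      ∀ q : Fin n, (w' q).val = if q.val < n - 1 - 1 - p then q.val
        else if q.val < n - 1 - 1 - p + m then n - 1 - p + (n - 1) - (q.val + 1)
        else if q.val = n - 1 - 1 - p + m then n - 1 - 1 - p
        else n - 1 - p + (n - 1) - q.val := by
  induction m with
  | zero =>
    refine ⟨w, by simpa using h, fun q => ?_⟩
    rw [hw]
    split_ifs <;> omega
  | succ m ih =>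
    obtain ⟨w', h', hw'⟩ := ih (by omega)
    have hk : n - 1 - 1 - p + m < n - 1 := by omega
    refine ⟨w' * simpleTransposition ⟨n - 1 - 1 - p + m, hk⟩, ?_, ?_⟩
    · rw [List.prod_range_succ, Finset.prod_range_succ, ← mul_assoc, ← mul_assoc]
      refine h'.mul_hFactor ⟨n - 1 - 1 - p + m, hk⟩ (z m) ?_
      rw [Fin.lt_def, hw', hw']
      dsimp only
      split_ifs <;> omega
    · intro q
      by_cases h1 : q.val = n - 1 - 1 - p + m
      · have e : q = ⟨(⟨n - 1 - 1 - p + m, hk⟩ : Fin (n - 1)).val, by dsimp only; omega⟩ :=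
          Fin.ext h1
        rw [e, mul_simple_apply_left, hw']
        dsimp only
        split_ifs <;> omega
      · by_cases h2 : q.val = n - 1 - 1 - p + m + 1
        · have e : q = ⟨(⟨n - 1 - 1 - p + m, hk⟩ : Fin (n - 1)).val + 1, by dsimp only; omega⟩ :=
            Fin.ext h2
          rw [e, mul_simple_apply_right, hw']
          dsimp only
          split_ifs <;> omega
        · rw [mul_simple_apply_of_ne _ _ _ h1 h2, hw']
          split_ifs <;> omega

/-- The factorization of the Fomin–Kirillov product has as many factors as the longest permutation
has inversions, and multiplying out the generators in order gives that permutation; hence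
all factors contribute to its coefficient. -/
theorem isTopEntry_fominKirillov {n : ℕ} (hn : 1 ≤ n) (ξ ψ : ℕ → R) :
    IsTopEntry (fominKirillov (n - 1) (heckeMatrix R n) ξ ψ) Fin.revPerm
      (∏ p ∈ Finset.range (n - 1), ∏ i ∈ Finset.range (p + 1),
        (ξ i + ψ (n - 1 - 1 - p) - ξ i * ψ (n - 1 - 1 - p))) := by
  rw [(isDegenerateHecke_heckeMatrix R n).fominKirillov_eq]
  have key : ∀ m ≤ n - 1, ∃ w : Equiv.Perm (Fin n),
      IsTopEntry ((List.range m).map fun p => ((List.range (p + 1)).map fun i =>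
        hFactor (heckeMatrix R n) (ξ i + ψ (n - 1 - 1 - p) - ξ i * ψ (n - 1 - 1 - p))
          (n - 1 - 1 - p + i)).prod).prod w
      (∏ p ∈ Finset.range m, ∏ i ∈ Finset.range (p + 1),
        (ξ i + ψ (n - 1 - 1 - p) - ξ i * ψ (n - 1 - 1 - p))) ∧
      ∀ q : Fin n, (w q).val =
        if q.val < n - 1 - m then q.val else n - 1 - m + (n - 1) - q.val := by
    intro m hm
    induction m with
    | zero =>
      refine ⟨1, ⟨fun σ hσ => ?_, by simp⟩, fun q => ?_⟩
      · rw [permLength_one] at hσ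
        have : (1 : Equiv.Perm (Fin n)) ≠ σ := by
          rintro rfl
          simp at hσ
        simp [this]
      · rw [Equiv.Perm.one_apply]
        split_ifs <;> omega
    | succ m ih =>
      obtain ⟨w, h, hw⟩ := ih (by omega)
      obtain ⟨w', h', hw'⟩ := h.mul_block (p := m) (by omega)
        (fun i => ξ i + ψ (n - 1 - 1 - m) - ξ i * ψ (n - 1 - 1 - m)) hw (m + 1) le_rfl
      rw [List.prod_range_succ, Finset.prod_range_succ]
      refine ⟨w', h', fun q => ?_⟩
      rw [hw']
      split_ifs <;> omega
  obtain ⟨w, h, hw⟩ := key _ le_rfl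
  have : w = Fin.revPerm := by
    ext q
    rw [hw, Fin.revPerm_apply, Fin.val_rev]
    split_ifs <;> omega
  rwa [this] at h

end MatrixRepresentation

/-! ### Double Grothendieck polynomials as matrix entries -/

/-- The Fomin–Kirillov product with its parameters specialized to the variables. -/
noncomputable def fominKirillovXY (n : ℕ) :
    Matrix (Equiv.Perm (Fin n)) (Equiv.Perm (Fin n)) DoublePoly :=
  fominKirillov (n - 1) (heckeMatrix DoublePoly n) (fun i => xVar (i + 1)) fun j => yVar (j + 1)

theorem fominKirillovXY_rev {n : ℕ} (hn : 1 ≤ n) :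
    fominKirillovXY n 1 Fin.revPerm = (-1) ^ permLength (Fin.revPerm : Equiv.Perm (Fin n)) *
      ∏ p ∈ (Finset.Icc 1 n ×ˢ Finset.Icc 1 n).filter (fun p => p.1 + p.2 ≤ n),
          (xVar p.1 + yVar p.2 - xVar p.1 * yVar p.2) := by
  rw [fominKirillovXY, (isTopEntry_fominKirillov hn _ _).2, Finset.prod_sigma']
  congr 1
  refine Finset.prod_bij' (fun a _ => (a.2 + 1, n - 1 - a.1)) (fun b _ => ⟨n - 1 - b.2, b.1 - 1⟩)
    ?_ ?_ ?_ ?_ ?_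
  · rintro ⟨a, b⟩ h
    simp only [Finset.mem_sigma, Finset.mem_range, Finset.mem_filter, Finset.mem_product,
      Finset.mem_Icc] at h ⊢
    omega
  · rintro ⟨a, b⟩ h
    simp only [Finset.mem_sigma, Finset.mem_range, Finset.mem_filter, Finset.mem_product,
      Finset.mem_Icc] at h ⊢
    omega
  · rintro ⟨a, b⟩ h
    simp only [Finset.mem_sigma, Finset.mem_range] at h
    simp only [Sigma.mk.injEq, heq_eq_eq]
    omega
  · rintro ⟨a, b⟩ h
    simp only [Finset.mem_filter, Finset.mem_product, Finset.mem_Icc] at h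
    simp only [Prod.mk.injEq]
    omega
  · rintro ⟨a, b⟩ h
    simp only [Finset.mem_sigma, Finset.mem_range] at h
    dsimp only
    rw [show n - 1 - 1 - a + 1 = n - 1 - a by omega]

theorem one_sub_xVar_ne_zero (i : ℕ) : (1 : DoublePoly) - xVar i ≠ 0 := by
  intro h
  have := congrArg (MvPolynomial.aeval fun _ => (0 : ℤ)) h
  simp [xVar] at this

theorem xVar_sub_xVar_succ_ne_zero (i : ℕ) : xVar i - xVar (i + 1) ≠ 0 := by
  intro h
  have := congrArg (MvPolynomial.aeval fun v : ℕ ⊕ ℕ => if v = Sum.inl i then (1 : ℤ) else 0) h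
  simp [xVar] at this

theorem fominKirillovXY_swapX {n : ℕ} (i : ℕ) (σ τ : Equiv.Perm (Fin n)) :
    fominKirillov (n - 1) (heckeMatrix DoublePoly n)
      ((fun i => xVar (i + 1)) ∘ Equiv.swap i (i + 1)) (fun j => yVar (j + 1)) σ τ =
        swapX (i + 1) (fominKirillovXY n σ τ) := by
  have := map_fominKirillov (MvPolynomial.rename (R := ℤ) (Equiv.swap (Sum.inl (i + 1))
    (Sum.inl (i + 1 + 1)) : Equiv.Perm (ℕ ⊕ ℕ))).toRingHom n (n - 1)
    (fun i => xVar (i + 1)) (fun j => yVar (j + 1))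
  have e1 : (MvPolynomial.rename (R := ℤ) (Equiv.swap (Sum.inl (i + 1))
      (Sum.inl (i + 1 + 1)) : Equiv.Perm (ℕ ⊕ ℕ))).toRingHom ∘ (fun i => xVar (i + 1)) =
      (fun i => xVar (i + 1)) ∘ Equiv.swap i (i + 1) := by
    funext j
    simp only [AlgHom.toRingHom_eq_coe, RingHom.coe_coe, Function.comp_apply, xVar,
      MvPolynomial.rename_X, Equiv.swap_apply_def]
    congr 1
    simp only [Sum.inl.injEq, Nat.add_right_cancel_iff]
    split_ifs <;> rfl
  have e2 : (MvPolynomial.rename (R := ℤ) (Equiv.swap (Sum.inl (i + 1))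
      (Sum.inl (i + 1 + 1)) : Equiv.Perm (ℕ ⊕ ℕ))).toRingHom ∘ (fun j => yVar (j + 1)) =
      (fun j => yVar (j + 1)) := by
    funext j
    simp [yVar, Equiv.swap_apply_def]
  rw [e1, e2] at this
  rw [← this]
  rfl

/-- The entries of the Fomin–Kirillov product satisfy the recursion of the double Grothendieck
polynomials, up to signs. -/
theorem isobaricDD_fominKirillovXY {n : ℕ} {w : Equiv.Perm (Fin n)} {k : Fin (n - 1)}
    (hw : w ⟨k.val, by omega⟩ < w ⟨k.val + 1, by omega⟩) :
    isobaricDD (k.val + 1) ((-1) ^ permLength (w * simpleTransposition k) *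
        fominKirillovXY n 1 (w * simpleTransposition k)) =
      (-1) ^ permLength w * fominKirillovXY n 1 w := by
  have hreg : IsSMulRegular (Matrix (Equiv.Perm (Fin n)) (Equiv.Perm (Fin n)) DoublePoly)
      (1 - xVar (k.val + 1)) := by
    intro a b h
    ext1 σ τ
    exact mul_left_cancel₀ (one_sub_xVar_ne_zero _) (congrFun (congrFun h σ) τ)
  have sym := (isDegenerateHecke_heckeMatrix DoublePoly n).fominKirillov_symm
    (fun i => xVar (i + 1)) (fun j => yVar (j + 1)) k.2 hreg
  have s1 := congrFun (congrFun sym 1) w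
  have s2 := congrFun (congrFun sym 1) (w * simpleTransposition k)
  rw [mul_hFactor_apply, mul_hFactor_apply, mul_heckeMatrix_apply_of_ascent hw,
    mul_heckeMatrix_apply_of_ascent hw, fominKirillovXY_swapX, ← fominKirillovXY] at s1
  rw [mul_hFactor_apply, mul_hFactor_apply, mul_heckeMatrix_apply_mul_simple hw,
    mul_heckeMatrix_apply_mul_simple hw, fominKirillovXY_swapX, fominKirillovXY_swapX,
    ← fominKirillovXY] at s2
  apply mul_left_cancel₀ (xVar_sub_xVar_succ_ne_zero (k.val + 1))
  have e : ∀ (m : ℕ) (f : DoublePoly),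
      swapX (k.val + 1) ((-1) ^ m * f) = (-1) ^ m * swapX (k.val + 1) f := by
    intro m f
    simp [swapX]
  rw [isobaricDD_spec, permLength_mul_simple w k hw, e]
  linear_combination (-(-1) ^ permLength w) * s2 + (-(-1) ^ permLength w * xVar (k.val + 1)) * s1

/-- The double Grothendieck polynomial of `w` is, up to sign, the coefficient of `w` in the
Fomin–Kirillov product. -/
theorem IsDoubleGrothendieck.eq_fominKirillovXY {n : ℕ} (hn : 1 ≤ n) {w : Equiv.Perm (Fin n)}
    {P : DoublePoly} (hP : IsDoubleGrothendieck w P) :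
    P = (-1) ^ permLength w * fominKirillovXY n 1 w := by
  induction hP with
  | longest =>
    rw [fominKirillovXY_rev hn, ← mul_assoc, ← mul_pow]
    simp
  | step w k P hlen _ ih => rw [ih, isobaricDD_fominKirillovXY (ascent_of_permLength w k hlen)]

/-! ### Extracting coefficients -/

section Coefficients

variable {V ι : Type*}

/-- The matrix of the coefficients at the monomial `d` of the entries of a matrix. -/
noncomputable def coeffMatrix (d : V →₀ ℕ) :
    Matrix ι ι (MvPolynomial V ℤ) →+ Matrix ι ι ℤ :=
  (MvPolynomial.coeffAddMonoidHom d).mapMatrix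

theorem coeffMatrix_apply (d : V →₀ ℕ) (M : Matrix ι ι (MvPolynomial V ℤ)) (i j : ι) :
    coeffMatrix d M i j = (M i j).coeff d := rfl

theorem coeffMatrix_neg_X_pow_smul (d : V →₀ ℕ) (z : V) (k : ℕ)
    (M : Matrix ι ι (MvPolynomial V ℤ)) :
    coeffMatrix d ((-MvPolynomial.X z : MvPolynomial V ℤ) ^ k • M) =
      if k ≤ d z then (-1) ^ k • coeffMatrix (d - Finsupp.single z k) M else 0 := by
  have e : (-MvPolynomial.X z : MvPolynomial V ℤ) ^ k =
      MvPolynomial.monomial (Finsupp.single z k) ((-1) ^ k) := by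
    rw [neg_pow, MvPolynomial.X_pow_eq_monomial, ← MvPolynomial.C_1, ← MvPolynomial.C_neg,
      ← MvPolynomial.C_pow, MvPolynomial.C_mul_monomial, mul_one]
  ext i j
  rw [coeffMatrix_apply, Matrix.smul_apply, smul_eq_mul, e, MvPolynomial.coeff_monomial_mul']
  simp only [Finsupp.single_le_iff]
  split_ifs <;> simp [coeffMatrix_apply]

variable [Fintype ι] [DecidableEq ι]

theorem coeffMatrix_mul_map_C (d : V →₀ ℕ) (M : Matrix ι ι (MvPolynomial V ℤ))
    (T : Matrix ι ι ℤ) : coeffMatrix d (M * MvPolynomial.C.mapMatrix T) = coeffMatrix d M * T := by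
  ext i j
  simp only [coeffMatrix_apply, Matrix.mul_apply, MvPolynomial.coeff_sum, RingHom.mapMatrix_apply,
    Matrix.map_apply]
  refine Finset.sum_congr rfl fun k _ => ?_
  rw [mul_comm, MvPolynomial.coeff_C_mul, mul_comm]

/-- Expansion of a product of factors `1 - x t_k` over the subwords of a word. -/
theorem prod_hFactor_eq_sum {R A : Type*} [CommRing R] [Ring A] [Algebra R A] (t : ℕ → A) (x : R)
    (L : List ℕ) : (L.map (hFactor t x)).prod =
      (L.sublists'.map fun l => (-x) ^ l.length • (l.map t).prod).sum := by
  induction L with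
  | nil => simp
  | cons k L ih =>
    rw [List.map_cons, List.prod_cons, List.sublists'_cons, List.map_append, List.sum_append, ← ih,
      hFactor, sub_mul, one_mul, sub_eq_add_neg, List.map_map, ih, smul_mul_assoc, ← neg_smul,
      ← List.sum_map_mul_left, List.smul_sum, List.map_map]
    congr 3
    funext l
    simp [pow_succ', mul_smul]

/-- The words which are concatenations of subwords of the words `L 0, …, L (m - 1)` of the
prescribed lengths `c 0, …, c (m - 1)`. -/
def blockWords (L : ℕ → List ℕ) (c : ℕ → ℕ) : ℕ → List (List ℕ)
  | 0 => [[]]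
  | m + 1 => (blockWords L c m).flatMap fun l =>
      ((L m).sublists'.filter fun l' => l'.length = c m).map fun l' => l ++ l'

theorem blockWords_congr (L : ℕ → List ℕ) {c c' : ℕ → ℕ} {m : ℕ} (h : ∀ k < m, c k = c' k) :
    blockWords L c m = blockWords L c' m := by
  induction m with
  | zero => rfl
  | succ m ih => rw [blockWords, blockWords, ih fun k hk => h k (by omega), h m (by omega)]

theorem sum_map_prod_flatMap_append {A : Type*} [Ring A] (t : ℕ → A) (ws S : List (List ℕ)) :
    ((ws.flatMap fun l => S.map fun l' => l ++ l').map fun l => (l.map t).prod).sum =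
      (ws.map fun l => (l.map t).prod).sum * (S.map fun l => (l.map t).prod).sum := by
  induction ws with
  | nil => simp
  | cons l ws ih =>
    have e : S.map ((fun l => (l.map t).prod) ∘ fun l' => l ++ l') =
        S.map fun l' => (l.map t).prod * (l'.map t).prod :=
      List.map_congr_left fun l' _ => by simp
    rw [List.flatMap_cons, List.map_append, List.sum_append, ih, List.map_cons, List.sum_cons,
      add_mul, List.map_map, e, List.sum_map_mul_left]

/-- The product of the factors `1 - X_z t_j` along a word of indices `j`, for integer matrices
`t_j`. -/
noncomputable def blockMatrix (t : ℕ → Matrix ι ι ℤ) (z : V) (L : List ℕ) :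
    Matrix ι ι (MvPolynomial V ℤ) :=
  (L.map (hFactor (fun j => (MvPolynomial.C (σ := V)).mapMatrix (t j))
    (MvPolynomial.X (R := ℤ) z))).prod

/-- The coefficient of a monomial in a product of blocks of factors `1 - X_{z k} t_j`, one
variable for each block: the exponents prescribe how many letters are chosen from each block. -/
theorem coeffMatrix_blockProd {t : ℕ → Matrix ι ι ℤ} {z : ℕ → V} {L : ℕ → List ℕ} {m : ℕ}
    (hz : Set.InjOn z (Set.Iio m)) (d : V →₀ ℕ) :
    ((∀ a, d a ≠ 0 → ∃ k < m, z k = a) →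
      coeffMatrix d ((List.range m).map fun k => blockMatrix t (z k) (L k)).prod =
      (-1) ^ (∑ k ∈ Finset.range m, d (z k)) •
        ((blockWords L (d ∘ z) m).map fun l => (l.map t).prod).sum) ∧
    ((¬ ∀ a, d a ≠ 0 → ∃ k < m, z k = a) →
      coeffMatrix d ((List.range m).map fun k => blockMatrix t (z k) (L k)).prod =
      0) := by
  induction m generalizing d with
  | zero =>
    constructor
    · intro h
      have hd : d = 0 := by
        ext a
        by_contra ha
        obtain ⟨k, hk, -⟩ := h a ha
        omega
      subst hd
      ext i j
      simp [coeffMatrix_apply, blockWords, Matrix.one_apply, apply_ite (MvPolynomial.coeff 0)]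
    · classical
      intro h
      have hd : 0 ≠ d := by
        rintro rfl
        simp at h
      ext i j
      have h1 : (1 : MvPolynomial V ℤ).coeff d = 0 := by rw [MvPolynomial.coeff_one, if_neg hd]
      simp [coeffMatrix_apply, Matrix.one_apply, apply_ite (MvPolynomial.coeff d), h1]
  | succ m ih =>
    have hz' : Set.InjOn z (Set.Iio m) := hz.mono fun k hk => Nat.lt_succ_of_lt hk
    have hne : ∀ k < m, z k ≠ z m := fun k hk e => by
      have := hz (show k < m + 1 by omega) (show m < m + 1 by omega) e
      omega
    have ih := fun d => ih hz' d
    simp only [List.prod_range_succ]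
    generalize ((List.range m).map fun k => blockMatrix t (z k) (L k)).prod = M at ih ⊢
    -- The earlier blocks do not involve `X_{z m}`, so that the last one takes all of it.
    have hM : ∀ l : List ℕ, coeffMatrix d (M * ((-MvPolynomial.X (R := ℤ) (z m)) ^ l.length •
        (l.map fun j => (MvPolynomial.C (σ := V)).mapMatrix (t j)).prod)) =
          if l.length = d (z m) then
            (-1) ^ d (z m) • (coeffMatrix (d.erase (z m)) M * (l.map t).prod) else 0 := by
      intro l
      have e : (l.map fun j => (MvPolynomial.C (σ := V)).mapMatrix (t j)).prod =
          MvPolynomial.C.mapMatrix (l.map t).prod := by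
        rw [map_list_prod, List.map_map]
        rfl
      rw [e, mul_smul_comm, coeffMatrix_neg_X_pow_smul, coeffMatrix_mul_map_C]
      rcases lt_trichotomy l.length (d (z m)) with h | h | h
      · rw [if_pos h.le, if_neg h.ne, (ih _).2, zero_mul, smul_zero]
        intro hc
        obtain ⟨k, hk, hk'⟩ := hc (z m) (by
          rw [Finsupp.tsub_apply, Finsupp.single_eq_same]
          omega)
        exact hne k hk hk'
      · have : d - Finsupp.single (z m) (d (z m)) = d.erase (z m) := by
          ext a
          by_cases ha : a = z m
          · subst ha
            simp
          · simp [ha]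
        rw [if_pos h.le, if_pos h, h, this]
      · rw [if_neg (by omega), if_neg h.ne']
    have hsum : coeffMatrix d (M * blockMatrix t (z m) (L m)) =
        (-1) ^ d (z m) • (coeffMatrix (d.erase (z m)) M *
          (((L m).sublists'.filter fun l' => l'.length = d (z m)).map fun l =>
            (l.map t).prod).sum) := by
      rw [blockMatrix, prod_hFactor_eq_sum, ← List.sum_map_mul_left, map_list_sum, List.map_map]
      generalize (L m).sublists' = s
      induction s with
      | nil => simp
      | cons l s ihs =>
        rw [List.map_cons, List.sum_cons, ihs, Function.comp_apply, hM, List.filter_cons]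
        split_ifs with h1 h2 h2 <;> simp_all [mul_add]
    rw [hsum]
    constructor
    · intro h
      have hd : ∀ k < m, (d.erase (z m)) (z k) = d (z k) := fun k hk =>
        Finsupp.erase_ne (hne k hk)
      have h1 := (ih (d.erase (z m))).1 (by
        intro a ha
        have ham : a ≠ z m := by
          rintro rfl
          simp at ha
        rw [Finsupp.erase_ne ham] at ha
        obtain ⟨k, hk, rfl⟩ := h a ha
        exact ⟨k, lt_of_le_of_ne (by omega) (by rintro rfl; exact ham rfl), rfl⟩)
      rw [h1, blockWords_congr L (c := d.erase (z m) ∘ z) (c' := d ∘ z) hd,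
        Finset.sum_congr rfl fun k hk => hd k (Finset.mem_range.1 hk), Finset.sum_range_succ,
        blockWords, sum_map_prod_flatMap_append, pow_add, mul_comm, mul_smul, smul_mul_assoc]
      rfl
    · intro h
      have h1 := (ih (d.erase (z m))).2 (by
        intro hc
        apply h
        intro a ha
        by_cases ham : a = z m
        · exact ⟨m, by omega, ham.symm⟩
        · obtain ⟨k, hk, hk'⟩ := hc a (by rwa [Finsupp.erase_ne ham])
          exact ⟨k, by omega, hk'⟩)
      simp [h1]

/-! ### Words composed of blocks -/

theorem nodup_blockWords {L : ℕ → List ℕ} (hL : ∀ k, (L k).Nodup) (c : ℕ → ℕ) (m : ℕ) :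
    (blockWords L c m).Nodup := by
  induction m with
  | zero => simp [blockWords]
  | succ m ih =>
    rw [blockWords, List.nodup_flatMap]
    refine ⟨fun l _ => ?_, ih.imp ?_⟩
    · exact (((List.nodup_sublists'.2 (hL m)).filter _).map fun a b h => List.append_cancel_left h)
    · intro a b hab l ha hb
      simp only [List.mem_map, List.mem_filter, decide_eq_true_eq] at ha hb
      obtain ⟨a', ⟨-, ha'⟩, rfl⟩ := ha
      obtain ⟨b', ⟨-, hb'⟩, h⟩ := hb
      exact hab (List.append_inj_left' h (hb'.trans ha'.symm)).symm

theorem mem_blockWords {L : ℕ → List ℕ} {c : ℕ → ℕ} {m : ℕ} {l : List ℕ} :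
    l ∈ blockWords L c m ↔ l.length = ∑ k ∈ Finset.range m, c k ∧
      ∀ k < m, ((l.drop (∑ j ∈ Finset.range k, c j)).take (c k)).Sublist (L k) := by
  induction m generalizing l with
  | zero => simp [blockWords]
  | succ m ih =>
    simp only [blockWords, List.mem_flatMap, List.mem_map, List.mem_filter, List.mem_sublists',
      decide_eq_true_eq, ih]
    constructor
    · rintro ⟨l, ⟨hl, hs⟩, l', ⟨hl's, hl'⟩, rfl⟩
      refine ⟨by rw [List.length_append, hl, hl', Finset.sum_range_succ], fun k hk => ?_⟩
      rcases Nat.lt_succ_iff_lt_or_eq.1 hk with hk | rfl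
      · have h1 : ∑ j ∈ Finset.range (k + 1), c j ≤ l.length := by
          rw [hl]
          exact Finset.sum_le_sum_of_subset (Finset.range_subset_range.2 hk)
        rw [Finset.sum_range_succ] at h1
        rw [List.drop_append_of_le_length (by omega), List.take_append_of_le_length]
        · exact hs k hk
        · rw [List.length_drop]
          omega
      · rw [← hl, List.drop_left, ← hl', List.take_length]
        exact hl's
    · rintro ⟨hl, hs⟩
      rw [Finset.sum_range_succ] at hl
      have hlen : (l.take (∑ k ∈ Finset.range m, c k)).length = ∑ k ∈ Finset.range m, c k := by
        rw [List.length_take]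
        omega
      have hlen' : (l.drop (∑ k ∈ Finset.range m, c k)).length = c m := by
        rw [List.length_drop]
        omega
      refine ⟨l.take (∑ k ∈ Finset.range m, c k), ⟨hlen, fun k hk => ?_⟩,
        l.drop (∑ k ∈ Finset.range m, c k), ⟨?_, hlen'⟩, List.take_append_drop _ _⟩
      · have h1 : ∑ j ∈ Finset.range (k + 1), c j ≤ ∑ k ∈ Finset.range m, c k :=
          Finset.sum_le_sum_of_subset (Finset.range_subset_range.2 hk)
        rw [Finset.sum_range_succ] at h1
        have := hs k (by omega)
        rwa [List.drop_take, List.take_take, min_eq_left (by omega)]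
      · have := hs m (by omega)
        rwa [← hlen', List.take_length] at this

theorem sublist_range'_iff {l : List ℕ} {i N : ℕ} :
    l.Sublist (List.range' i (N - i)) ↔ l.Pairwise (· < ·) ∧ ∀ a ∈ l, i ≤ a ∧ a < N := by
  constructor
  · intro h
    refine ⟨List.Pairwise.sublist h (List.pairwise_lt_range' ..), fun a ha => ?_⟩
    have := List.mem_range'_1.1 (h.subset ha)
    omega
  · rintro ⟨h1, h2⟩
    refine List.sublist_of_subperm_of_pairwise (r := (· < ·)) (List.subperm_of_subset ?_ ?_) h1
      List.pairwise_lt_range'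
    · exact h1.imp fun h => h.ne
    · intro a ha
      rw [List.mem_range'_1]
      have := h2 a ha
      omega

theorem sublist_reverse_range'_iff {l : List ℕ} {i N : ℕ} :
    l.Sublist (List.range' i (N - i)).reverse ↔
      l.Pairwise (fun a b => b < a) ∧ ∀ a ∈ l, i ≤ a ∧ a < N := by
  rw [← List.reverse_sublist, List.reverse_reverse, sublist_range'_iff, List.pairwise_reverse]
  simp

theorem pairwise_take_drop_ofFn {α : Type*} {r : ℕ} (f : Fin r → α) (a c : ℕ)
    (R : α → α → Prop) : (((List.ofFn f).drop a).take c).Pairwise R ↔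
      ∀ j k : Fin r, a ≤ j.val → j < k → k.val < a + c → R (f j) (f k) := by
  rw [List.pairwise_iff_getElem]
  simp only [List.getElem_take, List.getElem_drop, List.getElem_ofFn, List.length_take,
    List.length_drop, List.length_ofFn]
  constructor
  · intro h j k hj hjk hk
    rw [Fin.lt_def] at hjk
    have := h (j.val - a) (k.val - a) (by omega) (by omega) (by omega)
    simpa only [Nat.add_sub_cancel' hj, Nat.add_sub_cancel' (show a ≤ k.val by omega)] using this
  · intro h i j hi hj hij
    exact h ⟨a + i, by omega⟩ ⟨a + j, by omega⟩ (by dsimp only; omega)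
      (by rw [Fin.lt_def]; dsimp only; omega) (by dsimp only; omega)

theorem forall_mem_take_drop_ofFn {α : Type*} {r : ℕ} (f : Fin r → α) (a c : ℕ)
    (p : α → Prop) : (∀ x ∈ ((List.ofFn f).drop a).take c, p x) ↔
      ∀ j : Fin r, a ≤ j.val → j.val < a + c → p (f j) := by
  rw [List.forall_mem_iff_getElem]
  simp only [List.getElem_take, List.getElem_drop, List.getElem_ofFn, List.length_take,
    List.length_drop, List.length_ofFn]
  constructor
  · intro h j hj hk
    have := h (j.val - a) (by omega)
    simpa only [Nat.add_sub_cancel' hj] using this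
  · intro h i hi
    exact h ⟨a + i, by omega⟩ (by dsimp only; omega) (by dsimp only; omega)

end Coefficients

/-! ### Compatible sequences and the coefficient formula -/

/-- The variables of the blocks of the Fomin–Kirillov product: first `y_{n-1}, …, y_1`, then
`x_1, …, x_{n-1}`. -/
def blockVar (n k : ℕ) : ℕ ⊕ ℕ :=
  if k < n - 1 then Sum.inr (n - 1 - k) else Sum.inl (k - (n - 1) + 1)

/-- The zero-based indices of the generators in the blocks of the Fomin–Kirillov product, increasing
in the blocks that belong to the `y`s and decreasing in those that belong to the `x`s. -/
def blockLetters (n k : ℕ) : List ℕ :=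
  if k < n - 1 then List.range' (n - 1 - 1 - k) (n - 1 - (n - 1 - 1 - k))
  else (List.range' (k - (n - 1)) (n - 1 - (k - (n - 1)))).reverse

theorem nodup_blockLetters (n k : ℕ) : (blockLetters n k).Nodup := by
  unfold blockLetters
  split_ifs
  · exact List.nodup_range'
  · exact List.nodup_reverse.2 List.nodup_range'

theorem injOn_blockVar (n : ℕ) : Set.InjOn (blockVar n) (Set.Iio (n - 1 + (n - 1))) := by
  intro a ha b hb h
  rw [Set.mem_Iio] at ha hb
  unfold blockVar at h
  split_ifs at h <;> simp only [Sum.inl.injEq, Sum.inr.injEq] at h <;> omega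

theorem fominKirillovXY_eq_blockProd (n : ℕ) :
    fominKirillovXY n = ((List.range (n - 1 + (n - 1))).map fun k =>
      blockMatrix (heckeMatrix ℤ n) (blockVar n k) (blockLetters n k)).prod := by
  have ht : (fun j => (MvPolynomial.C (σ := ℕ ⊕ ℕ)).mapMatrix (heckeMatrix ℤ n j)) =
      heckeMatrix DoublePoly n := by
    funext j
    exact map_heckeMatrix _ n j
  rw [List.range_add, List.map_append, List.prod_append, List.map_map]
  simp only [blockMatrix, ht]
  unfold fominKirillovXY fominKirillov ascChain descChain
  congr 2
  · refine List.map_congr_left fun k hk => ?_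
    have hk := List.mem_range.1 hk
    rw [blockLetters, if_pos hk, blockVar, if_pos hk, ascProd,
      show n - 1 - k = n - 1 - 1 - k + 1 by omega]
    rfl
  · refine List.map_congr_left fun k hk => ?_
    have hk := List.mem_range.1 hk
    rw [Function.comp_apply, blockLetters, if_neg (by omega), blockVar, if_neg (by omega), descProd,
      Nat.add_sub_cancel_left, zero_add]
    rfl

theorem doubleMonomial_inl (n : ℕ) (u v : ℕ → ℕ) (k : ℕ) :
    doubleMonomial n u v (Sum.inl k) = if k ∈ Finset.Icc 1 (n - 1) then u k else 0 := by
  simp [doubleMonomial, Finsupp.single_apply]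

theorem doubleMonomial_inr (n : ℕ) (u v : ℕ → ℕ) (k : ℕ) :
    doubleMonomial n u v (Sum.inr k) = if k ∈ Finset.Icc 1 (n - 1) then v k else 0 := by
  simp [doubleMonomial, Finsupp.single_apply]

theorem doubleMonomial_blockVar_of_lt {n : ℕ} (u v : ℕ → ℕ) {k : ℕ} (hk : k < n - 1) :
    doubleMonomial n u v (blockVar n k) = v (n - 1 - k) := by
  rw [blockVar, if_pos hk, doubleMonomial_inr, if_pos]
  rw [Finset.mem_Icc]
  omega

theorem doubleMonomial_blockVar_add {n : ℕ} (u v : ℕ → ℕ) {k : ℕ} (hk : k < n - 1) :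
    doubleMonomial n u v (blockVar n (n - 1 + k)) = u (k + 1) := by
  rw [blockVar, if_neg (by omega), doubleMonomial_inl, if_pos, Nat.add_sub_cancel_left]
  rw [Finset.mem_Icc]
  omega

theorem exists_blockVar_eq {n : ℕ} {u v : ℕ → ℕ} {a : ℕ ⊕ ℕ} (ha : doubleMonomial n u v a ≠ 0) :
    ∃ k < n - 1 + (n - 1), blockVar n k = a := by
  rcases a with a | a
  · rw [doubleMonomial_inl, ne_eq, ite_eq_right_iff, Classical.not_imp, Finset.mem_Icc] at ha
    refine ⟨n - 1 + (a - 1), by omega, ?_⟩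
    rw [blockVar, if_neg (by omega)]
    congr 1
    omega
  · rw [doubleMonomial_inr, ne_eq, ite_eq_right_iff, Classical.not_imp, Finset.mem_Icc] at ha
    refine ⟨n - 1 - a, by omega, ?_⟩
    rw [blockVar, if_pos (by omega)]
    congr 1
    omega

theorem gIndex_succ {n : ℕ} (v : ℕ → ℕ) {k : ℕ} (hk : k < n - 1) :
    gIndex n v (k + 1) = gIndex n v k + v (n - 1 - k) := by
  unfold gIndex
  rw [show n - (k + 1) = n - 1 - k by omega, ← Finset.insert_Icc_succ_left_eq_Icc (by omega),
    Finset.sum_insert (by simp), add_comm, Order.succ_eq_add_one,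
    show n - 1 - k + 1 = n - k by omega]

theorem fIndex_succ (n : ℕ) (u v : ℕ → ℕ) (k : ℕ) :
    fIndex n u v (k + 1) = fIndex n u v k + u (k + 1) := by
  unfold fIndex
  rw [Finset.sum_Icc_succ_top (by omega), add_assoc]

theorem sum_doubleMonomial_of_le {n : ℕ} (hn : 1 ≤ n) (u v : ℕ → ℕ) {k : ℕ} (hk : k ≤ n - 1) :
    ∑ j ∈ Finset.range k, doubleMonomial n u v (blockVar n j) = gIndex n v k := by
  induction k with
  | zero =>
    rw [Finset.sum_range_zero, gIndex, Finset.Icc_eq_empty (by omega), Finset.sum_empty]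
  | succ k ih =>
    rw [Finset.sum_range_succ, ih (by omega), gIndex_succ v (by omega),
      doubleMonomial_blockVar_of_lt u v (by omega)]

theorem sum_doubleMonomial_add {n : ℕ} (hn : 1 ≤ n) (u v : ℕ → ℕ) {k : ℕ} (hk : k ≤ n - 1) :
    ∑ j ∈ Finset.range (n - 1 + k), doubleMonomial n u v (blockVar n j) = fIndex n u v k := by
  induction k with
  | zero =>
    rw [add_zero, sum_doubleMonomial_of_le hn u v le_rfl, fIndex, Finset.Icc_eq_empty (by omega),
      Finset.sum_empty, add_zero]
  | succ k ih =>
    rw [← add_assoc, Finset.sum_range_succ, ih (by omega), fIndex_succ,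
      doubleMonomial_blockVar_add u v (by omega)]

/-- The zero-based word of a sequence of positive indices. -/
def indexWord {r : ℕ} (e : Fin r → ℕ+) : List ℕ := List.ofFn fun j => (e j).natPred

theorem indexWord_injective {r : ℕ} : Function.Injective (indexWord (r := r)) := by
  intro e e' h
  funext j
  exact PNat.natPred_injective (congrFun (List.ofFn_injective h) j)

theorem map_heckeSucc_indexWord {r : ℕ} (e : Fin r → ℕ+) :
    (indexWord e).map heckeSucc = List.ofFn fun j => heckeGen (e j) := by
  unfold indexWord
  rw [List.map_ofFn]
  congr 1
  funext j
  simp [heckeSucc]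

/-- Compatible sequences are the concatenations of subwords of the blocks whose lengths are the
exponents of the monomial. -/
theorem indexWord_mem_blockWords_iff {n : ℕ} (hn : 1 ≤ n) (u v : ℕ → ℕ)
    (e : Fin (fIndex n u v (n - 1)) → ℕ+) (he : ∀ j, (e j).natPred < n - 1) :
    indexWord e ∈ blockWords (blockLetters n) (doubleMonomial n u v ∘ blockVar n)
      (n - 1 + (n - 1)) ↔ IsCompatibleSeq n u v e := by
  have hlt : ∀ a b : ℕ+, a.natPred < b.natPred ↔ a < b := fun a b => PNat.natPred_lt_natPred
  have hval : ∀ a : ℕ+, (a : ℕ) = a.natPred + 1 := fun a => a.natPred_add_one.symm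
  have hy : ∀ k < n - 1, ((((indexWord e).drop (gIndex n v k)).take (v (n - 1 - k))).Sublist
      (blockLetters n k) ↔
        (∀ j, gIndex n v k < j.val + 1 → j.val + 1 ≤ gIndex n v (k + 1) → n - (k + 1) ≤ (e j : ℕ)) ∧
        (∀ j l, gIndex n v k < j.val + 1 → j < l → l.val + 1 ≤ gIndex n v (k + 1) →
          e j < e l)) := by
    intro k hk
    rw [blockLetters, if_pos hk, sublist_range'_iff, indexWord, pairwise_take_drop_ofFn,
      forall_mem_take_drop_ofFn, gIndex_succ v hk]
    simp only [hlt]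
    constructor
    · rintro ⟨h1, h2⟩
      refine ⟨fun j hj hj' => ?_, fun j l hj hjl hl => h1 j l (by omega) hjl (by omega)⟩
      have := h2 j (by omega) (by omega)
      have := hval (e j)
      omega
    · rintro ⟨h1, h2⟩
      refine ⟨fun j l hj hjl hl => h2 j l (by omega) hjl (by omega), fun j hj hj' => ⟨?_, he j⟩⟩
      have := h1 j (by omega) (by omega)
      have := hval (e j)
      omega
  have hx : ∀ k < n - 1, ((((indexWord e).drop (fIndex n u v k)).take (u (k + 1))).Sublist
      (blockLetters n (n - 1 + k)) ↔
        (∀ j l, fIndex n u v k < j.val + 1 → j < l → l.val + 1 ≤ fIndex n u v (k + 1) →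
          e l < e j) ∧
        (∀ j, fIndex n u v k < j.val + 1 → j.val + 1 ≤ fIndex n u v (k + 1) →
          k + 1 ≤ (e j : ℕ))) := by
    intro k hk
    rw [blockLetters, if_neg (by omega), Nat.add_sub_cancel_left, sublist_reverse_range'_iff,
      indexWord, pairwise_take_drop_ofFn, forall_mem_take_drop_ofFn, fIndex_succ]
    simp only [hlt]
    constructor
    · rintro ⟨h1, h2⟩
      refine ⟨fun j l hj hjl hl => h1 j l (by omega) hjl (by omega), fun j hj hj' => ?_⟩
      have := h2 j (by omega) (by omega)
      have := hval (e j)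
      omega
    · rintro ⟨h1, h2⟩
      refine ⟨fun j l hj hjl hl => h1 j l (by omega) hjl (by omega), fun j hj hj' => ⟨?_, he j⟩⟩
      have := h2 j (by omega) (by omega)
      have := hval (e j)
      omega
  rw [mem_blockWords]
  simp only [Function.comp_apply]
  rw [sum_doubleMonomial_add hn u v le_rfl, indexWord, List.length_ofFn, ← indexWord]
  simp only [true_and]
  constructor
  · intro h i hi
    obtain ⟨h1, h2⟩ := Finset.mem_Icc.1 hi
    obtain ⟨k, rfl⟩ : ∃ k, i = k + 1 := ⟨i - 1, by omega⟩
    have a1 := h k (by omega)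
    rw [sum_doubleMonomial_of_le hn u v (by omega), doubleMonomial_blockVar_of_lt u v (by omega),
      hy k (by omega)] at a1
    have a2 := h (n - 1 + k) (by omega)
    rw [sum_doubleMonomial_add hn u v (by omega), doubleMonomial_blockVar_add u v (by omega),
      hx k (by omega)] at a2
    exact ⟨a1.1, a1.2, a2.1, a2.2⟩
  · intro h k hk
    rcases Nat.lt_or_ge k (n - 1) with hk' | hk'
    · rw [sum_doubleMonomial_of_le hn u v (by omega), doubleMonomial_blockVar_of_lt u v (by omega),
        hy k (by omega)]
      obtain ⟨b1, b2, -, -⟩ := h (k + 1) (Finset.mem_Icc.2 ⟨by omega, by omega⟩)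
      exact ⟨b1, b2⟩
    · obtain ⟨k, rfl⟩ := Nat.exists_eq_add_of_le hk'
      rw [sum_doubleMonomial_add hn u v (by omega), doubleMonomial_blockVar_add u v (by omega),
        hx k (by omega)]
      obtain ⟨-, -, b1, b2⟩ := h (k + 1) (Finset.mem_Icc.2 ⟨by omega, by omega⟩)
      exact ⟨b1, b2⟩

theorem image_indexWord_bjsFactorizations {n : ℕ} (hn : 1 ≤ n) (w : Equiv.Perm (Fin n))
    (u v : ℕ → ℕ) : indexWord '' bjsFactorizations w u v =
      {l | l ∈ blockWords (blockLetters n) (doubleMonomial n u v ∘ blockVar n) (n - 1 + (n - 1)) ∧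
        (l.map heckeSucc).prod = heckeOfPerm w} := by
  ext l
  constructor
  · rintro ⟨e, ⟨h1, h2⟩, rfl⟩
    rw [← map_heckeSucc_indexWord] at h1
    refine ⟨(indexWord_mem_blockWords_iff hn u v e fun j => ?_).2 h2, h1⟩
    exact lt_of_prod_heckeSucc_eq h1 (List.mem_ofFn.2 ⟨j, rfl⟩)
  · rintro ⟨h1, h2⟩
    have hlen : l.length = fIndex n u v (n - 1) := by
      rw [(mem_blockWords.1 h1).1]
      exact sum_doubleMonomial_add hn u v le_rfl
    obtain ⟨e, rfl⟩ : ∃ e : Fin (fIndex n u v (n - 1)) → ℕ+, indexWord e = l := by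
      refine ⟨fun j => (l[j.val]'(by omega)).succPNat, ?_⟩
      apply List.ext_getElem
      · simp [indexWord, hlen]
      · intro i _ _
        simp [indexWord]
    refine ⟨e, ⟨by rwa [← map_heckeSucc_indexWord],
      (indexWord_mem_blockWords_iff hn u v e fun j => ?_).1 h1⟩, rfl⟩
    exact lt_of_prod_heckeSucc_eq h2 (List.mem_ofFn.2 ⟨j, rfl⟩)

theorem mainTheorem5 (n : ℕ) (hn : 1 ≤ n) (w : Equiv.Perm (Fin n)) (u v : ℕ → ℕ)
    (P : DoublePoly) (hP : IsDoubleGrothendieck w P) :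
    (bjsFactorizations w u v).Finite ∧
      P.coeff (doubleMonomial n u v) =
        ((((fIndex n u v (n - 1) : ℕ) : ℤ) - (permLength w : ℤ)).negOnePow : ℤ) *
          ((bjsFactorizations w u v).ncard : ℤ) := by
  classical
  set ws := blockWords (blockLetters n) (doubleMonomial n u v ∘ blockVar n) (n - 1 + (n - 1))
    with hws
  have himage : indexWord '' bjsFactorizations w u v =
      ↑(ws.filter fun l => (l.map heckeSucc).prod = heckeOfPerm w).toFinset := by
    rw [image_indexWord_bjsFactorizations hn]
    ext l
    simp [hws]
  have hnodup : ws.Nodup := nodup_blockWords (nodup_blockLetters n) _ _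
  have hcard : (bjsFactorizations w u v).ncard =
      (ws.filter fun l => (l.map heckeSucc).prod = heckeOfPerm w).length := by
    rw [← Set.ncard_image_of_injective _ indexWord_injective, himage, Set.ncard_coe_finset,
      List.toFinset_card_of_nodup (hnodup.filter _)]
  refine ⟨Set.Finite.of_finite_image (f := indexWord) (by rw [himage]; exact Finset.finite_toSet _)
    indexWord_injective.injOn, ?_⟩
  have hcoeff : (fominKirillovXY n 1 w).coeff (doubleMonomial n u v) =
      (-1) ^ fIndex n u v (n - 1) * ((bjsFactorizations w u v).ncard : ℤ) := by
    have := (coeffMatrix_blockProd (t := heckeMatrix ℤ n) (L := blockLetters n)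
      (injOn_blockVar n) (doubleMonomial n u v)).1 fun a ha => exists_blockVar_eq ha
    rw [← fominKirillovXY_eq_blockProd, sum_doubleMonomial_add hn u v le_rfl, ← hws] at this
    rw [← coeffMatrix_apply, this, Matrix.smul_apply, smul_eq_mul, hcard]
    congr 1
    clear_value ws
    clear this hcard himage hws hnodup
    induction ws with
    | nil => simp
    | cons l ws ih =>
      rw [List.map_cons, List.sum_cons, Matrix.add_apply, ih, prod_heckeMatrix_apply,
        List.filter_cons]
      by_cases h : (l.map heckeSucc).prod = heckeOfPerm w
      · simp [h, add_comm]
      · simp [h]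
  have hsign : ((((fIndex n u v (n - 1) : ℕ) : ℤ) - (permLength w : ℤ)).negOnePow : ℤ) =
      (-1) ^ permLength w * (-1) ^ fIndex n u v (n - 1) := by
    rw [Int.negOnePow_sub, Int.negOnePow_def, Int.negOnePow_def, zpow_natCast, zpow_natCast,
      mul_comm]
    push_cast
    rfl
  have hC : (-1 : DoublePoly) ^ permLength w = MvPolynomial.C ((-1) ^ permLength w) := by
    rw [map_pow, map_neg, map_one]
  rw [hP.eq_fominKirillovXY hn, hC, MvPolynomial.coeff_C_mul, hcoeff, hsign, mul_assoc]
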